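/- **Theorem.** For a subgroup $G\le \mathrm{PSL}(2,\mathbb C)$ let $\mathbb Q(\mathrm{tr}\,G)\subset\mathbb C$ be the field generated over $\mathbb Q$ by the traces of all elements of the preimage of $G$ in $\mathrm{SL}(2,\mathbb C)$, and let the invariant trace field $k(G)$ be the intersection of the fields $\mathbb Q(\mathrm{tr}\,H)$ over all finite index subgroups $H$ of $G$. Below, "the root of $p$ at $v$" means a root $x\in\mathbb C$ of $p$ with $|x-v|<10^{-8}$. For $i=0,\dots,6$ let $z$ be the root of $P_i$ at $v_i$ (such a root exists), where - $P_0=x^8+2x^6+6x^4+2x^2+1$, $v_0=0.853230697-1.252448658i$; - $P_1=x^8-2x^7+5x^6-4x^5+7x^4-4x^3+5x^2-2x+1$, $v_1=0.904047196-1.471654224i$; - $P_2=x^4-2x^3+4x^2-2x+1$, $v_2=0.742934136-1.529085514i$; - $P_3=x^{24}-8x^{23}+35x^{22}-107x^{21}+261x^{20}-538x^{19}+972x^{18}-1565x^{17}+2282x^{16}-3034x^{15}+3706x^{14}-4171x^{13}+4339x^{12}-4171x^{11}+3706x^{10}-3034x^9+2282x^8-1565x^7+972x^6-538x^5+261x^4-107x^3+35x^2-8x+1$,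 $v_3=1.404292212-1.179267298i$; - $P_4=x^6-3x^5+5x^4-4x^3+5x^2-3x+1$, $v_4=1.354619901-1.225125454i$; - $P_5=x^{12}+2x^{10}+7x^8-4x^6+7x^4+2x^2+1$, $v_5=0.868063287-1.460023666i$; - $P_6=x^{12}-2x^{10}+7x^8+4x^6+7x^4-2x^2+1$, $v_6=1.460023666-0.868063287i$. Define $t=t_i(z)$ and $s=s_i(z)$ by - $t_0=-z-6z^3-2z^5-z^7$, $\;s_0=(-5z^2-2z^4-z^6)/2$; - $t_1=2-4z+4z^2-7z^3+4z^4-5z^5+2z^6-z^7$, $\;s_1=t_1$; - $t_2=2-3z+2z^2-z^3$, $\;s_2=t_2$; - $t_3=8-34z+107z^2-261z^3+538z^4-972z^5+1565z^6-2282z^7+3034z^8-3706z^9+4171z^{10}-4339z^{11}+4171z^{12}-3706z^{13}+3034z^{14}-2282z^{15}+1565z^{16}-972z^{17}+538z^{18}-261z^{19}+107z^{20}-35z^{21}+8z^{22}-z^{23}$, $\;s_3=t_3$; - $t_4=3-4z+4z^2-5z^3+3z^4-z^5$, $\;s_4=t_4$; - $t_5=-z-7z^3+4z^5-7z^7-2z^9-z^{11}$,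 $\;s_5=(-6z^2+4z^4-7z^6-2z^8-z^{10})/2$; - $t_6=3z-7z^3-4z^5-7z^7+2z^9-z^{11}$, $\;s_6=(4-6z^2-4z^4-7z^6+2z^8-z^{10})/2$. Then $$f=\begin{pmatrix}0&1\\-1&t\end{pmatrix},\qquad w=\begin{pmatrix}z&0\\ tz-s&t-z\end{pmatrix}$$ lie in $\mathrm{SL}(2,\mathbb C)$. Let $G_i$, the marked group of the region $X_i$, be the subgroup of $\mathrm{PSL}(2,\mathbb C)$ generated by the images of $f$ and $w$. For $i\le 5$ the following two words, the quasi-relators of $X_i$, are trivial in $G_i$: - $X_0$: $fwf^{-1}w^2f^{-1}wfw^2$ and $f^{-1}wfwfw^{-1}fwfw$; - $X_1$: $f^{-2}wf^{-1}w^{-1}f^{-1}w^{-1}fw^{-1}f^{-1}w^{-1}f^{-1}wf^{-2}w^2$ and $f^{-2}w^2f^{-1}wfwfw^{-1}fwfwf^{-1}w^2$; - $X_2$: $f^{-1}wfwfw^{-1}f^2w^{-1}fwfwf^{-1}w^2$ and $f^{-2}wf^{-2}w^2f^{-1}wfwfwf^{-1}w^2$; - $X_3$: $f^{-2}wfwf^{-2}w^2f^{-1}w^{-1}f^{-1}wf^{-1}w^{-1}(fw^{-1}f^{-1}w^{-1}f)^2w^{-1}f^{-1}wf^{-1}w^{-1}f^{-1}w^2$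 and $f^{-2}wfwf^{-1}wf(w^{-1}fwfw^{-1})^2fwf^{-1}wfwf^{-2}w^2f^{-1}w^{-1}f^{-1}w^2$; - $X_4$: $f^{-2}wfwf^{-1}(wfw^{-1}f)^2wf^{-1}wfwf^{-2}w^2(f^{-1}w^{-1}f^{-1}w)^2w$ and $f^{-1}(f^{-1}wfw)^2f^{-2}w^2f^{-1}w^{-1}f^{-1}w(f^{-1}w^{-1}fw^{-1})^2f^{-1}wf^{-1}w^{-1}f^{-1}w^2$; - $X_5$: $f^{-1}wf^{-1}w^{-1}f^{-1}wf^{-1}wfwfw^{-1}fwfw$ and $f^{-1}wfwfw^{-1}fw^{-1}f^{-1}w^{-1}fw^{-1}fwfw$. Moreover, for every $i=0,\dots,6$, as subfields of $\mathbb C$, $$k(G_i)=\mathbb Q(\tau_i),$$ where $\tau_i$ has minimal polynomial $Q_i$ over $\mathbb Q$ and is the root of $Q_i$ at $u_i$: - $Q_0=x^2+3$, $u_0=1.732050808i$; - $Q_1=x^4-2x^3+x^2-2x+1$, $u_1=-0.207106781+0.978318343i$; - $Q_2=x^2+1$, $u_2=i$; - $Q_3=x^{12}+6x^{11}+23x^{10}+91x^9+257x^8+489x^7+823x^6+1054x^5-13x^4-2445x^3-3405x^2-1847x-337$,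 $u_3=0.632778000-3.019170376i$; - $Q_4=x^3-x-2$, $u_4=-0.760689853+0.857873626i$; - $Q_5=x^3-x^2+x+1$, $u_5=0.771844506+1.11514250i$; - $Q_6=x^3-x^2+x+1$, $u_6=0.771844506-1.11514250i$. -/

import Mathlib

open scoped MatrixGroups
open Polynomial

noncomputable section

/-- The group `PSL(2, ℂ)`. -/
abbrev PSLTwoC : Type := Matrix.ProjectiveSpecialLinearGroup (Fin 2) ℂ

/-- The quotient homomorphism `SL(2, ℂ) → PSL(2, ℂ)`. -/
def toPSL : SL(2, ℂ) →* PSLTwoC :=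
  QuotientGroup.mk' (Subgroup.center SL(2, ℂ))

/-- The trace field `ℚ(tr H)` of a subgroup `H` of `PSL(2, ℂ)`: the subfield of `ℂ` generated by the
traces of all the elements of the preimage of `H` in `SL(2, ℂ)`. -/
def traceField (H : Subgroup PSLTwoC) : IntermediateField ℚ ℂ :=
  IntermediateField.adjoin ℚ
    {t : ℂ | ∃ A : SL(2, ℂ), toPSL A ∈ H ∧ t = (A : Matrix (Fin 2) (Fin 2) ℂ).trace}

/-- The invariant trace field `k(G)`: the intersection of the trace fields of all the subgroups of
finite index in `G`. -/
def invariantTraceField (G : Subgroup PSLTwoC) : IntermediateField ℚ ℂ :=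
  sInf {K | ∃ H : Subgroup PSLTwoC, H ≤ G ∧ H.relIndex G ≠ 0 ∧ K = traceField H}

/-- The subgroup of `PSL(2, ℂ)` generated by the images of two elements of `SL(2, ℂ)`. -/
def generatedGroup (f w : SL(2, ℂ)) : Subgroup PSLTwoC :=
  Subgroup.closure {toPSL f, toPSL w}

/-- `x` is a root of `p` whose numerical value is `v`, to the tabulated precision. -/
def IsTabulatedRoot (p : ℚ[X]) (v x : ℂ) : Prop :=
  aeval x p = 0 ∧ ‖x - v‖ < 1 / 10 ^ 8

/-! ### The quasi-relators -/

/-- The first quasi-relator of each of the regions `X₀, …, X₅`. -/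
def quasiRelatorOne {Γ : Type*} [Group Γ] (f w : Γ) : Fin 6 → Γ
  | 0 => f * w * f⁻¹ * w ^ 2 * f⁻¹ * w * f * w ^ 2
  | 1 => f⁻¹ ^ 2 * w * f⁻¹ * w⁻¹ * f⁻¹ * w⁻¹ * f * w⁻¹ * f⁻¹ * w⁻¹ * f⁻¹ * w * f⁻¹ ^ 2 * w ^ 2
  | 2 => f⁻¹ * w * f * w * f * w⁻¹ * f ^ 2 * w⁻¹ * f * w * f * w * f⁻¹ * w ^ 2
  | 3 => f⁻¹ ^ 2 * w * f * w * f⁻¹ ^ 2 * w ^ 2 * f⁻¹ * w⁻¹ * f⁻¹ * w * f⁻¹ * w⁻¹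
          * (f * w⁻¹ * f⁻¹ * w⁻¹ * f) ^ 2 * w⁻¹ * f⁻¹ * w * f⁻¹ * w⁻¹ * f⁻¹ * w ^ 2
  | 4 => f⁻¹ ^ 2 * w * f * w * f⁻¹ * (w * f * w⁻¹ * f) ^ 2 * w * f⁻¹ * w * f * w * f⁻¹ ^ 2 * w ^ 2
          * (f⁻¹ * w⁻¹ * f⁻¹ * w) ^ 2 * w
  | 5 => f⁻¹ * w * f⁻¹ * w⁻¹ * f⁻¹ * w * f⁻¹ * w * f * w * f * w⁻¹ * f * w * f * w

/-- The second quasi-relator of each of the regions `X₀, …, X₅`. -/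
def quasiRelatorTwo {Γ : Type*} [Group Γ] (f w : Γ) : Fin 6 → Γ
  | 0 => f⁻¹ * w * f * w * f * w⁻¹ * f * w * f * w
  | 1 => f⁻¹ ^ 2 * w ^ 2 * f⁻¹ * w * f * w * f * w⁻¹ * f * w * f * w * f⁻¹ * w ^ 2
  | 2 => f⁻¹ ^ 2 * w * f⁻¹ ^ 2 * w ^ 2 * f⁻¹ * w * f * w * f * w * f⁻¹ * w ^ 2
  | 3 => f⁻¹ ^ 2 * w * f * w * f⁻¹ * w * f * (w⁻¹ * f * w * f * w⁻¹) ^ 2 * f * w * f⁻¹ * w * f * w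
          * f⁻¹ ^ 2 * w ^ 2 * f⁻¹ * w⁻¹ * f⁻¹ * w ^ 2
  | 4 => f⁻¹ * (f⁻¹ * w * f * w) ^ 2 * f⁻¹ ^ 2 * w ^ 2 * f⁻¹ * w⁻¹ * f⁻¹ * w
          * (f⁻¹ * w⁻¹ * f * w⁻¹) ^ 2 * f⁻¹ * w * f⁻¹ * w⁻¹ * f⁻¹ * w ^ 2
  | 5 => f⁻¹ * w * f * w * f * w⁻¹ * f * w⁻¹ * f⁻¹ * w⁻¹ * f * w⁻¹ * f * w * f * w

/-! ### The marked groups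

The generators of the marked group of `Xᵢ` are the matrices with the traces
`tr f = tr w = markedTrace i z`, `tr (f⁻¹ w) = markedTraceThree i z` below. -/

/-- The polynomial over `ℚ` of which the parameter `z` of the marked group of `Xᵢ` is a root. -/
def markedPoly : Fin 7 → ℚ[X]
  | 0 => X ^ 8 + 2 * X ^ 6 + 6 * X ^ 4 + 2 * X ^ 2 + 1
  | 1 => X ^ 8 - 2 * X ^ 7 + 5 * X ^ 6 - 4 * X ^ 5 + 7 * X ^ 4 - 4 * X ^ 3 + 5 * X ^ 2 - 2 * X + 1
  | 2 => X ^ 4 - 2 * X ^ 3 + 4 * X ^ 2 - 2 * X + 1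
  | 3 => X ^ 24 - 8 * X ^ 23 + 35 * X ^ 22 - 107 * X ^ 21 + 261 * X ^ 20 - 538 * X ^ 19
          + 972 * X ^ 18 - 1565 * X ^ 17 + 2282 * X ^ 16 - 3034 * X ^ 15 + 3706 * X ^ 14
          - 4171 * X ^ 13 + 4339 * X ^ 12 - 4171 * X ^ 11 + 3706 * X ^ 10 - 3034 * X ^ 9
          + 2282 * X ^ 8 - 1565 * X ^ 7 + 972 * X ^ 6 - 538 * X ^ 5 + 261 * X ^ 4 - 107 * X ^ 3
          + 35 * X ^ 2 - 8 * X + 1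
  | 4 => X ^ 6 - 3 * X ^ 5 + 5 * X ^ 4 - 4 * X ^ 3 + 5 * X ^ 2 - 3 * X + 1
  | 5 => X ^ 12 + 2 * X ^ 10 + 7 * X ^ 8 - 4 * X ^ 6 + 7 * X ^ 4 + 2 * X ^ 2 + 1
  | 6 => X ^ 12 - 2 * X ^ 10 + 7 * X ^ 8 + 4 * X ^ 6 + 7 * X ^ 4 - 2 * X ^ 2 + 1

/-- The numerical value of the parameter `z` of the marked group of `Xᵢ`. -/
def markedValue : Fin 7 → ℂ
  | 0 => ⟨0.853230697, -1.252448658⟩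
  | 1 => ⟨0.904047196, -1.471654224⟩
  | 2 => ⟨0.742934136, -1.529085514⟩
  | 3 => ⟨1.404292212, -1.179267298⟩
  | 4 => ⟨1.354619901, -1.225125454⟩
  | 5 => ⟨0.868063287, -1.460023666⟩
  | 6 => ⟨1.460023666, -0.868063287⟩

/-- The common trace of `f` and `w`, as a polynomial in `z`. -/
def markedTrace : Fin 7 → ℂ → ℂ
  | 0, z => -z - 6 * z ^ 3 - 2 * z ^ 5 - z ^ 7
  | 1, z => 2 - 4 * z + 4 * z ^ 2 - 7 * z ^ 3 + 4 * z ^ 4 - 5 * z ^ 5 + 2 * z ^ 6 - z ^ 7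
  | 2, z => 2 - 3 * z + 2 * z ^ 2 - z ^ 3
  | 3, z => 8 - 34 * z + 107 * z ^ 2 - 261 * z ^ 3 + 538 * z ^ 4 - 972 * z ^ 5 + 1565 * z ^ 6
          - 2282 * z ^ 7 + 3034 * z ^ 8 - 3706 * z ^ 9 + 4171 * z ^ 10 - 4339 * z ^ 11
          + 4171 * z ^ 12 - 3706 * z ^ 13 + 3034 * z ^ 14 - 2282 * z ^ 15 + 1565 * z ^ 16
          - 972 * z ^ 17 + 538 * z ^ 18 - 261 * z ^ 19 + 107 * z ^ 20 - 35 * z ^ 21 + 8 * z ^ 22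
          - z ^ 23
  | 4, z => 3 - 4 * z + 4 * z ^ 2 - 5 * z ^ 3 + 3 * z ^ 4 - z ^ 5
  | 5, z => -z - 7 * z ^ 3 + 4 * z ^ 5 - 7 * z ^ 7 - 2 * z ^ 9 - z ^ 11
  | 6, z => 3 * z - 7 * z ^ 3 - 4 * z ^ 5 - 7 * z ^ 7 + 2 * z ^ 9 - z ^ 11

/-- The trace of `f⁻¹ w`, as a polynomial in `z`. -/
def markedTraceThree : Fin 7 → ℂ → ℂ
  | 0, z => (-5 * z ^ 2 - 2 * z ^ 4 - z ^ 6) / 2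
  | 1, z => markedTrace 1 z
  | 2, z => markedTrace 2 z
  | 3, z => markedTrace 3 z
  | 4, z => markedTrace 4 z
  | 5, z => (-6 * z ^ 2 + 4 * z ^ 4 - 7 * z ^ 6 - 2 * z ^ 8 - z ^ 10) / 2
  | 6, z => (4 - 6 * z ^ 2 - 4 * z ^ 4 - 7 * z ^ 6 + 2 * z ^ 8 - z ^ 10) / 2

/-- The matrix of the first generator `f` of the marked group of `Xᵢ`. -/
def markedMatrixF (i : Fin 7) (z : ℂ) : Matrix (Fin 2) (Fin 2) ℂ :=
  !![0, 1; -1, markedTrace i z]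

/-- The matrix of the second generator `w` of the marked group of `Xᵢ`. -/
def markedMatrixW (i : Fin 7) (z : ℂ) : Matrix (Fin 2) (Fin 2) ℂ :=
  !![z, 0; markedTrace i z * z - markedTraceThree i z, markedTrace i z - z]

/-! ### The table of fields -/

/-- The minimal polynomial of the tabulated generator of the invariant trace field of `Xᵢ`. -/
def fieldPoly : Fin 7 → ℚ[X]
  | 0 => X ^ 2 + 3
  | 1 => X ^ 4 - 2 * X ^ 3 + X ^ 2 - 2 * X + 1
  | 2 => X ^ 2 + 1
  | 3 => X ^ 12 + 6 * X ^ 11 + 23 * X ^ 10 + 91 * X ^ 9 + 257 * X ^ 8 + 489 * X ^ 7 + 823 * X ^ 6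
          + 1054 * X ^ 5 - 13 * X ^ 4 - 2445 * X ^ 3 - 3405 * X ^ 2 - 1847 * X - 337
  | 4 => X ^ 3 - X - 2
  | 5 => X ^ 3 - X ^ 2 + X + 1
  | 6 => X ^ 3 - X ^ 2 + X + 1

/-- The numerical value of the tabulated generator of the invariant trace field of `Xᵢ`. -/
def fieldValue : Fin 7 → ℂ
  | 0 => ⟨0, 1.732050808⟩
  | 1 => ⟨-0.207106781, 0.978318343⟩
  | 2 => ⟨0, 1⟩
  | 3 => ⟨0.632778000, -3.019170376⟩
  | 4 => ⟨-0.760689853, 0.857873626⟩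
  | 5 => ⟨0.771844506, 1.11514250⟩
  | 6 => ⟨0.771844506, -1.11514250⟩

end

/-! Each `markedPoly` gives `z * t = z ^ 2 + 1`, so `f` and `w` have common trace `t = z + 1/z`, and
both are loxodromic because `|z| > 1`. With `s = tr (f⁻¹ w)`, the main point is that `k(G) = ℚ(t ^
2, s)` (`invariantTraceField_generatedGroup`).

Lower bound. A subgroup `H` of finite index in `G` contains a normal subgroup `N` of `G` of some
finite index `n`. For `g` over `G`, the linear map `M ↦ g M g⁻¹` on `2 × 2` matrices has trace `(tr
g) ^ 2`. It can be computed in the basis formed by `1`, the trace-zero parts of `A = f ^ n` and `B =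
w ^ n`, and their commutator, with the dual basis for the trace form. Only traces of elements over
`N` then occur, so `(tr g) ^ 2` lies in `ℚ(tr N)` (`gramDisc_mul_trace_sq`). The basis is
nondegenerate because powers of the two loxodromics still generate an irreducible group. Taking `g =
f, f w, f⁻¹ w` yields `t ^ 2` and `s`.

Upper bound. Over a field `k` containing `t ^ 2` and `s`, right multiplication by `f` or `w`
exchanges the `k`-spans of `1, t f, t w, f w` and of `t, f, w, t f w`. The elements preserving both
spans have traces in `k` and meet `G` in a subgroup of index at most 2.

What remains is arithmetic. Here `s` is `t` or `t ^ 2 / 2`, and `t` is a root of an explicit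
rational polynomial, so each quasi-relator is verified by computing in `ℚ[t]` modulo that
polynomial. It is trivial already in `SL(2, ℂ)`. The generator `τ` is `t ^ 2 - 2` or an affine
function of `s`. Irreducibility of its polynomial comes from a prime value at an integer far from
the roots, or twice a prime. Rational error bounds at a 45-digit approximation of `z` select the
right roots. -/

section TraceIdentity

/-! ### Trace identities for `2 × 2` matrices and their powers. -/

variable {R : Type*} [CommRing R]

/-- The Gram determinant of the trace-zero parts of two `2 × 2` matrices, for the trace form
`2 * tr (A * B)`. -/
def gramDisc (A B : Matrix (Fin 2) (Fin 2) R) : R :=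
  (2 * (A * A).trace - A.trace ^ 2) * (2 * (B * B).trace - B.trace ^ 2)
    - (2 * (A * B).trace - A.trace * B.trace) ^ 2

/-- Adding scalars does not change trace-zero parts, and the Gram determinant is quadratic in each
of them. This carries irreducibility from `f, w` to their powers. -/
theorem gramDisc_smul_add (A B : Matrix (Fin 2) (Fin 2) R) (a b : R) :
    gramDisc (a • A + b • 1) (a • B + b • 1) = a ^ 4 * gramDisc A B := by
  simp only [gramDisc, Matrix.trace_fin_two, Matrix.mul_apply, Fin.sum_univ_two, Matrix.add_apply,
    Matrix.smul_apply, Matrix.one_apply_eq, smul_eq_mul, Matrix.one_apply,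
    Fin.isValue, zero_ne_one, one_ne_zero, if_true, if_false]
  ring

/-- The Casimir identity `∑ eᵢ N eᵢ* = tr N` for the trace form on `2 × 2` matrices, in the basis
given by `1`, the trace-zero parts of `A` and `B`, and their commutator. -/
theorem gramDisc_mul_trace_sq (A B g : Matrix (Fin 2) (Fin 2) R) :
    gramDisc A B * g.trace ^ 2 = gramDisc A B * g.det
      + (2 * (B * B).trace - B.trace ^ 2)
          * (2 * (g * A * g.adjugate * A).trace - g.det * A.trace ^ 2)
      - (2 * (A * B).trace - A.trace * B.trace)
          * (2 * (g * A * g.adjugate * B).trace + 2 * (g * B * g.adjugate * A).trace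
            - 2 * g.det * (A.trace * B.trace))
      + (2 * (A * A).trace - A.trace ^ 2)
          * (2 * (g * B * g.adjugate * B).trace - g.det * B.trace ^ 2)
      - 2 * ((g * (A * B) * g.adjugate * (A * B)).trace - (g * (A * B) * g.adjugate * (B * A)).trace
          - (g * (B * A) * g.adjugate * (A * B)).trace
          + (g * (B * A) * g.adjugate * (B * A)).trace) := by
  obtain ⟨a, b, c, d, rfl⟩ : ∃ a b c d, A = !![a, b; c, d] := ⟨_, _, _, _, A.eta_fin_two⟩
  obtain ⟨a', b', c', d', rfl⟩ : ∃ a b c d, B = !![a, b; c, d] := ⟨_, _, _, _, B.eta_fin_two⟩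
  obtain ⟨p, q, r, s, rfl⟩ : ∃ a b c d, g = !![a, b; c, d] := ⟨_, _, _, _, g.eta_fin_two⟩
  simp only [gramDisc, Matrix.adjugate_fin_two_of, Matrix.mul_fin_two, Matrix.trace_fin_two_of,
    Matrix.det_fin_two_of]
  ring

/-- A power of a `2 × 2` matrix with eigenvalues `z, z⁻¹`, as a combination of it and `1`, with
coefficients depending only on `z`. -/
theorem exists_pow_eq_smul_add {z t : ℂ} (hz : 1 < ‖z‖) (ht : z * t = z ^ 2 + 1) {n : ℕ}
    (hn : n ≠ 0) : ∃ a b : ℂ, a ≠ 0 ∧ ∀ M : Matrix (Fin 2) (Fin 2) ℂ, M.trace = t → M.det = 1 →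
      M ^ n = a • M + b • 1 := by
  have hz0 : z ≠ 0 := fun h => by simp [h] at hz; linarith
  -- As `|z| > 1`, no positive power of `z` is `1`. This keeps both the denominator and the
  -- coefficient `a` nonzero.
  have hne : ∀ k : ℕ, k ≠ 0 → z ^ (2 * k) - 1 ≠ 0 := fun k hk h => by
    have h1 : ‖z‖ ^ (2 * k) = 1 := by rw [← norm_pow, sub_eq_zero.1 h, norm_one]
    exact (one_lt_pow₀ hz (by omega : 2 * k ≠ 0)).ne' h1
  have hd : z ^ 2 - 1 ≠ 0 := by simpa using hne 1 one_ne_zero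
  obtain ⟨m, rfl⟩ := Nat.exists_eq_succ_of_ne_zero hn
  -- This is `M ^ (m + 1) = U (m + 1) • M - U m • 1` with `U j = (z ^ j - z ^ (-j)) / (z - z⁻¹)`,
  -- cleared of denominators.
  have key : ∀ m : ℕ, ∀ M : Matrix (Fin 2) (Fin 2) ℂ, M.trace = t → M.det = 1 →
      (z ^ m * (z ^ 2 - 1)) • M ^ (m + 1)
        = (z ^ (2 * (m + 1)) - 1) • M + (-z * (z ^ (2 * m) - 1)) • 1 := by
    intro m M hM hdet
    have hsq : z • (M * M) = (z ^ 2 + 1) • M - z • 1 := by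
      rw [← ht, ← hM]
      obtain ⟨p, q, r, s, rfl⟩ : ∃ a b c d, M = !![a, b; c, d] := ⟨_, _, _, _, M.eta_fin_two⟩
      rw [Matrix.det_fin_two_of] at hdet
      simp only [Matrix.mul_fin_two, Matrix.trace_fin_two_of, Matrix.one_fin_two, Matrix.smul_of,
        Matrix.smul_cons, smul_eq_mul, Matrix.smul_empty]
      ext i j
      fin_cases i <;> fin_cases j <;> simp <;>
        first | ring1 | linear_combination -z * hdet
    induction m with
    | zero => simp
    | succ m ih =>
      have : (z ^ (m + 1) * (z ^ 2 - 1)) • M ^ (m + 1 + 1)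
          = z • (((z ^ m * (z ^ 2 - 1)) • M ^ (m + 1)) * M) := by
        rw [pow_succ M (m + 1), smul_mul_assoc, smul_smul]; ring_nf
      rw [this, ih, add_mul, smul_mul_assoc, smul_mul_assoc, one_mul, smul_add, smul_comm z, hsq]
      module
  refine ⟨(z ^ m * (z ^ 2 - 1))⁻¹ * (z ^ (2 * (m + 1)) - 1),
    (z ^ m * (z ^ 2 - 1))⁻¹ * (-z * (z ^ (2 * m) - 1)),
    mul_ne_zero (inv_ne_zero (mul_ne_zero (pow_ne_zero _ hz0) hd)) (hne _ (by omega)),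
    fun M hM hdet => ?_⟩
  rw [mul_smul, mul_smul, ← smul_add, ← key m M hM hdet, smul_smul,
    inv_mul_cancel₀ (mul_ne_zero (pow_ne_zero _ hz0) hd), one_smul]

end TraceIdentity

/-! ### Lower bound: squares of traces lie in the trace field of every finite index subgroup. -/

theorem trace_mem_traceField {H : Subgroup PSLTwoC} {A : SL(2, ℂ)} (hA : toPSL A ∈ H) :
    (A : Matrix (Fin 2) (Fin 2) ℂ).trace ∈ traceField H :=
  IntermediateField.subset_adjoin ℚ _ ⟨A, hA, rfl⟩

theorem traceField_mono {H₁ H₂ : Subgroup PSLTwoC} (h : H₁ ≤ H₂) :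
    traceField H₁ ≤ traceField H₂ :=
  IntermediateField.adjoin.mono _ _ _ fun _ ⟨A, hA, ht⟩ => ⟨A, h hA, ht⟩

/-- If conjugation by `g` preserves `H`, and `H` contains the images of `A`, `B` that generate an
irreducible group, then the square of the trace of `g` lies in the trace field of `H`. -/
theorem trace_sq_mem_traceField_of_conj {H : Subgroup PSLTwoC} {A B g : SL(2, ℂ)}
    (hA : toPSL A ∈ H) (hB : toPSL B ∈ H)
    (hg : ∀ x ∈ H, toPSL g * x * (toPSL g)⁻¹ ∈ H)
    (hD : gramDisc (A : Matrix (Fin 2) (Fin 2) ℂ) (B : Matrix (Fin 2) (Fin 2) ℂ) ≠ 0) :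
    (g : Matrix (Fin 2) (Fin 2) ℂ).trace ^ 2 ∈ traceField H := by
  have hmul : ∀ X Y : SL(2, ℂ), toPSL X ∈ H → toPSL Y ∈ H →
      ((X : Matrix (Fin 2) (Fin 2) ℂ) * (Y : Matrix (Fin 2) (Fin 2) ℂ)).trace ∈ traceField H := by
    intro X Y hX hY
    rw [← Matrix.SpecialLinearGroup.coe_mul]
    exact trace_mem_traceField (by rw [map_mul]; exact mul_mem hX hY)
  have hconj : ∀ X Y : SL(2, ℂ), toPSL X ∈ H → toPSL Y ∈ H →
      ((g : Matrix (Fin 2) (Fin 2) ℂ) * (X : Matrix (Fin 2) (Fin 2) ℂ)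
        * (g : Matrix (Fin 2) (Fin 2) ℂ).adjugate * (Y : Matrix (Fin 2) (Fin 2) ℂ)).trace
        ∈ traceField H := by
    intro X Y hX hY
    rw [← Matrix.SpecialLinearGroup.coe_inv, ← Matrix.SpecialLinearGroup.coe_mul,
      ← Matrix.SpecialLinearGroup.coe_mul]
    exact hmul _ _ (by rw [map_mul, map_mul, map_inv]; exact hg _ hX) hY
  have hAB : toPSL (A * B) ∈ H := by rw [map_mul]; exact mul_mem hA hB
  have hBA : toPSL (B * A) ∈ H := by rw [map_mul]; exact mul_mem hB hA
  have tA := trace_mem_traceField hA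
  have tB := trace_mem_traceField hB
  have c1 := hconj _ _ hAB hAB
  have c2 := hconj _ _ hAB hBA
  have c3 := hconj _ _ hBA hAB
  have c4 := hconj _ _ hBA hBA
  rw [Matrix.SpecialLinearGroup.coe_mul] at c1 c2 c3 c4
  rw [Matrix.SpecialLinearGroup.coe_mul] at c2 c3
  have key := gramDisc_mul_trace_sq (A : Matrix (Fin 2) (Fin 2) ℂ) (B : Matrix (Fin 2) (Fin 2) ℂ)
    (g : Matrix (Fin 2) (Fin 2) ℂ)
  rw [Matrix.SpecialLinearGroup.det_coe] at key
  have hDmem : gramDisc (A : Matrix (Fin 2) (Fin 2) ℂ) (B : Matrix (Fin 2) (Fin 2) ℂ)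
      ∈ traceField H := by
    have two : (2 : ℂ) ∈ traceField H := ofNat_mem _ 2
    have := hmul _ _ hA hA
    have := hmul _ _ hA hB
    have := hmul _ _ hB hB
    unfold gramDisc
    repeat' with_reducible first
      | assumption | apply pow_mem | apply add_mem | apply sub_mem | apply mul_mem
  have : gramDisc (A : Matrix (Fin 2) (Fin 2) ℂ) (B : Matrix (Fin 2) (Fin 2) ℂ)
      * (g : Matrix (Fin 2) (Fin 2) ℂ).trace ^ 2 ∈ traceField H := by
    rw [key]
    have two : (2 : ℂ) ∈ traceField H := ofNat_mem _ 2
    have one : (1 : ℂ) ∈ traceField H := one_mem _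
    have := hmul _ _ hA hA
    have := hmul _ _ hA hB
    have := hmul _ _ hB hB
    have := hconj _ _ hA hA
    have := hconj _ _ hA hB
    have := hconj _ _ hB hA
    have := hconj _ _ hB hB
    repeat' with_reducible first
      | assumption | apply pow_mem | apply add_mem | apply sub_mem | apply mul_mem
  have h2 := mul_mem (inv_mem hDmem) this
  rwa [inv_mul_cancel_left₀ hD] at h2

/-- If `H` has finite index in `G`, and `G` contains the images of loxodromic elements `f` and `w`
with the same trace that generate an irreducible group, then the trace field of `H` contains the
squares of the traces of all elements of `G`. -/
theorem trace_sq_mem_traceField_of_finiteIndex {f w : SL(2, ℂ)} {z t : ℂ} (hz : 1 < ‖z‖)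
    (ht : z * t = z ^ 2 + 1) (hf : (f : Matrix (Fin 2) (Fin 2) ℂ).trace = t)
    (hw : (w : Matrix (Fin 2) (Fin 2) ℂ).trace = t)
    (hD : gramDisc (f : Matrix (Fin 2) (Fin 2) ℂ) (w : Matrix (Fin 2) (Fin 2) ℂ) ≠ 0)
    {H G : Subgroup PSLTwoC} (hfG : toPSL f ∈ G) (hwG : toPSL w ∈ G) (hH : H.relIndex G ≠ 0)
    {g : SL(2, ℂ)} (hg : toPSL g ∈ G) :
    (g : Matrix (Fin 2) (Fin 2) ℂ).trace ^ 2 ∈ traceField H := by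
  have : (H.subgroupOf G).FiniteIndex := ⟨hH⟩
  obtain ⟨N, hN⟩ : ∃ N, N = (H.subgroupOf G).normalCore := ⟨_, rfl⟩
  have hle : N.map G.subtype ≤ H := by
    rintro _ ⟨x, hx, rfl⟩
    rw [hN] at hx
    exact Subgroup.mem_subgroupOf.1 (Subgroup.normalCore_le (H.subgroupOf G) hx)
  have hn : N.index ≠ 0 := hN ▸ Subgroup.FiniteIndex.index_ne_zero
  have hnorm : N.Normal := hN ▸ (H.subgroupOf G).normalCore_normal
  have hpow : ∀ x : SL(2, ℂ), toPSL x ∈ G → toPSL (x ^ N.index) ∈ N.map G.subtype := by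
    intro x hx
    exact ⟨⟨toPSL x, hx⟩ ^ N.index, Subgroup.pow_index_mem N _,
      by rw [map_pow, map_pow, Subgroup.subtype_apply]⟩
  refine traceField_mono hle (trace_sq_mem_traceField_of_conj (hpow f hfG) (hpow w hwG) ?_ ?_)
  · rintro _ ⟨x, hx, rfl⟩
    obtain ⟨γ, hγ⟩ : ∃ γ : G, (γ : PSLTwoC) = toPSL g := ⟨⟨_, hg⟩, rfl⟩
    rw [← hγ]
    exact ⟨γ * x * γ⁻¹, hnorm.conj_mem x hx γ, by simp⟩
  -- Equal traces give the same `a` and `b` for both powers, so the Gram determinant is only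
  -- multiplied by `a ^ 4 ≠ 0`.
  · obtain ⟨a, b, ha, hM⟩ := exists_pow_eq_smul_add hz ht hn
    rw [Matrix.SpecialLinearGroup.coe_pow, Matrix.SpecialLinearGroup.coe_pow,
      hM _ hf f.det_coe, hM _ hw w.det_coe, gramDisc_smul_add]
    exact mul_ne_zero (pow_ne_zero _ ha) hD

/-! ### Multiplication in the coordinates `1, f, w, f w`. -/

section Comb

variable {R : Type*} [CommRing R]

/-- The combination of `1, f, w, f * w` with the given coefficients. -/
def comb (f w : Matrix (Fin 2) (Fin 2) R) (a b c d : R) : Matrix (Fin 2) (Fin 2) R :=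
  a • 1 + b • f + c • w + d • (f * w)

variable {f w : Matrix (Fin 2) (Fin 2) R} {t s : R}

theorem Matrix.mul_self_fin_two (M : Matrix (Fin 2) (Fin 2) R) :
    M * M = M.trace • M - M.det • 1 := by
  obtain ⟨p, q, r, s, rfl⟩ : ∃ a b c d, M = !![a, b; c, d] := ⟨_, _, _, _, M.eta_fin_two⟩
  ext i j
  fin_cases i <;> fin_cases j <;>
    simp [Matrix.trace_fin_two_of, Matrix.det_fin_two_of] <;> ring

theorem Matrix.mul_add_mul_fin_two (A B : Matrix (Fin 2) (Fin 2) R) :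
    B * A = B.trace • A + A.trace • B - A * B + ((A * B).trace - A.trace * B.trace) • 1 := by
  obtain ⟨p, q, r, s, rfl⟩ : ∃ a b c d, A = !![a, b; c, d] := ⟨_, _, _, _, A.eta_fin_two⟩
  obtain ⟨p', q', r', s', rfl⟩ : ∃ a b c d, B = !![a, b; c, d] := ⟨_, _, _, _, B.eta_fin_two⟩
  ext i j
  fin_cases i <;> fin_cases j <;>
    simp [Matrix.trace_fin_two_of] <;> ring

/-- Matrices `f`, `w` of determinant `1` with `tr f = tr w = t` and `tr (f⁻¹ w) = s`. -/
structure IsMarkedPair (f w : Matrix (Fin 2) (Fin 2) R) (t s : R) : Prop where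
  det_left : f.det = 1
  det_right : w.det = 1
  trace_left : f.trace = t
  trace_right : w.trace = t
  trace_mul : (f * w).trace = t ^ 2 - s

namespace IsMarkedPair

variable (h : IsMarkedPair f w t s)
include h

theorem left_mul_left : f * f = t • f - 1 := by
  rw [Matrix.mul_self_fin_two, h.trace_left, h.det_left, one_smul]

theorem right_mul_right : w * w = t • w - 1 := by
  rw [Matrix.mul_self_fin_two, h.trace_right, h.det_right, one_smul]

theorem right_mul_left : w * f = t • f + t • w - f * w - s • 1 := by
  rw [Matrix.mul_add_mul_fin_two, h.trace_left, h.trace_right, h.trace_mul]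
  module

/-- The only new product is `f w f = w + (t ^ 2 - s) f - t`. These coordinate formulas serve both
the parity argument and the evaluation of the quasi-relators. -/
theorem comb_mul_left (a b c d : R) :
    comb f w a b c d * f = comb f w (-(b + s * c + t * d))
      (a + t * (b + c) + (t * t - s) * d) (t * c + d) (-c) := by
  have h1 : f * w * f = w + (t ^ 2 - s) • f - t • 1 := by
    rw [mul_assoc, h.right_mul_left, mul_sub, mul_sub, mul_add, ← mul_assoc, mul_smul_comm,
      mul_smul_comm, mul_smul_comm, h.left_mul_left, sub_mul, smul_mul_assoc, mul_one, one_mul]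
    module
  simp only [comb, add_mul, smul_mul_assoc, one_mul, h1, h.left_mul_left, h.right_mul_left]
  module

theorem comb_mul_right (a b c d : R) :
    comb f w a b c d * w = comb f w (-c) (-d) (a + t * c) (b + t * d) := by
  simp only [comb, add_mul, smul_mul_assoc, one_mul, mul_assoc, h.right_mul_right, mul_sub,
    mul_smul_comm, mul_one]
  module

theorem trace_comb (a b c d : R) :
    (comb f w a b c d).trace = 2 * a + t * b + t * c + (t ^ 2 - s) * d := by
  simp only [comb, Matrix.trace_add, Matrix.trace_smul, h.trace_left, h.trace_right, h.trace_mul,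
    Matrix.trace_one, Fintype.card_fin, smul_eq_mul]
  push_cast
  ring

/-- For determinant one this quantity is `-4 (tr [f, w] - 2)`, so it is nonzero exactly when the
pair is irreducible. -/
theorem gramDisc_eq : gramDisc f w = 4 * ((s - 2) * (t ^ 2 - 2 - s)) := by
  rw [gramDisc, h.left_mul_left, h.right_mul_right, h.trace_mul]
  simp only [Matrix.trace_sub, Matrix.trace_smul, h.trace_left, h.trace_right, Matrix.trace_one,
    Fintype.card_fin, smul_eq_mul]
  push_cast
  ring

end IsMarkedPair

theorem comb_add (a b c d a' b' c' d' : R) :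
    comb f w a b c d + comb f w a' b' c' d' = comb f w (a + a') (b + b') (c + c') (d + d') := by
  simp only [comb]; module

theorem smul_comb (r a b c d : R) :
    r • comb f w a b c d = comb f w (r * a) (r * b) (r * c) (r * d) := by
  simp only [comb]; module

end Comb

theorem eq_or_eq_neg_of_toPSL_eq {A B : SL(2, ℂ)} (h : toPSL A = toPSL B) : A = B ∨ A = -B := by
  have h1 : B⁻¹ * A ∈ Subgroup.center SL(2, ℂ) := QuotientGroup.eq.1 h.symm
  obtain ⟨r, hr, hr'⟩ := Matrix.SpecialLinearGroup.mem_center_iff.1 h1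
  have hA : (A : Matrix (Fin 2) (Fin 2) ℂ) = r • (B : Matrix (Fin 2) (Fin 2) ℂ) := by
    have : A = B * (B⁻¹ * A) := by group
    rw [this, Matrix.SpecialLinearGroup.coe_mul, ← hr', Matrix.scalar_apply,
      ← Matrix.smul_one_eq_diagonal, mul_smul_comm, mul_one]
  rcases mul_self_eq_one_iff.1 (by simpa [sq] using hr : r * r = 1) with rfl | rfl
  · left; ext i j; simp [hA]
  · right; ext i j; simp [hA]

/-! ### Parity of elements of the group. -/

section Parity

variable (k : IntermediateField ℚ ℂ) (t : ℂ) (f w : Matrix (Fin 2) (Fin 2) ℂ)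

/-- The `k`-span of `1, t f, t w, f w` (if `t ^ 2 ∈ k`). -/
def evenSpan : Set (Matrix (Fin 2) (Fin 2) ℂ) :=
  {M | ∃ a b c d, a ∈ k ∧ t * b ∈ k ∧ t * c ∈ k ∧ d ∈ k ∧ M = comb f w a b c d}

/-- The `k`-span of `t, f, w, t f w` (if `t ^ 2 ∈ k`). -/
def oddSpan : Set (Matrix (Fin 2) (Fin 2) ℂ) :=
  {M | ∃ a b c d, t * a ∈ k ∧ b ∈ k ∧ c ∈ k ∧ t * d ∈ k ∧ M = comb f w a b c d}

variable {k t f w}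

theorem add_mem_evenSpan {M N : Matrix (Fin 2) (Fin 2) ℂ} (hM : M ∈ evenSpan k t f w)
    (hN : N ∈ evenSpan k t f w) : M + N ∈ evenSpan k t f w := by
  obtain ⟨a, b, c, d, ha, hb, hc, hd, rfl⟩ := hM
  obtain ⟨a', b', c', d', ha', hb', hc', hd', rfl⟩ := hN
  exact ⟨_, _, _, _, add_mem ha ha', by rw [mul_add]; exact add_mem hb hb',
    by rw [mul_add]; exact add_mem hc hc', add_mem hd hd', comb_add ..⟩

theorem add_mem_oddSpan {M N : Matrix (Fin 2) (Fin 2) ℂ} (hM : M ∈ oddSpan k t f w)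
    (hN : N ∈ oddSpan k t f w) : M + N ∈ oddSpan k t f w := by
  obtain ⟨a, b, c, d, ha, hb, hc, hd, rfl⟩ := hM
  obtain ⟨a', b', c', d', ha', hb', hc', hd', rfl⟩ := hN
  exact ⟨_, _, _, _, by rw [mul_add]; exact add_mem ha ha', add_mem hb hb', add_mem hc hc',
    by rw [mul_add]; exact add_mem hd hd', comb_add ..⟩

theorem smul_mem_evenSpan {r : ℂ} (hr : r ∈ k) {M : Matrix (Fin 2) (Fin 2) ℂ}
    (hM : M ∈ evenSpan k t f w) : r • M ∈ evenSpan k t f w := by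
  obtain ⟨a, b, c, d, ha, hb, hc, hd, rfl⟩ := hM
  exact ⟨_, _, _, _, mul_mem hr ha, by rw [mul_left_comm]; exact mul_mem hr hb,
    by rw [mul_left_comm]; exact mul_mem hr hc, mul_mem hr hd, smul_comb ..⟩

theorem smul_mem_oddSpan {r : ℂ} (hr : r ∈ k) {M : Matrix (Fin 2) (Fin 2) ℂ}
    (hM : M ∈ oddSpan k t f w) : r • M ∈ oddSpan k t f w := by
  obtain ⟨a, b, c, d, ha, hb, hc, hd, rfl⟩ := hM
  exact ⟨_, _, _, _, by rw [mul_left_comm]; exact mul_mem hr ha, mul_mem hr hb, mul_mem hr hc,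
    by rw [mul_left_comm]; exact mul_mem hr hd, smul_comb ..⟩

theorem smul_trace_mem_oddSpan (ht : t ^ 2 ∈ k) {M : Matrix (Fin 2) (Fin 2) ℂ}
    (hM : M ∈ evenSpan k t f w) : t • M ∈ oddSpan k t f w := by
  obtain ⟨a, b, c, d, ha, hb, hc, hd, rfl⟩ := hM
  exact ⟨_, _, _, _, by rw [← mul_assoc, ← sq]; exact mul_mem ht ha, hb, hc,
    by rw [← mul_assoc, ← sq]; exact mul_mem ht hd, smul_comb ..⟩

theorem smul_trace_mem_evenSpan (ht : t ^ 2 ∈ k) {M : Matrix (Fin 2) (Fin 2) ℂ}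
    (hM : M ∈ oddSpan k t f w) : t • M ∈ evenSpan k t f w := by
  obtain ⟨a, b, c, d, ha, hb, hc, hd, rfl⟩ := hM
  exact ⟨_, _, _, _, ha, by rw [← mul_assoc, ← sq]; exact mul_mem ht hb,
    by rw [← mul_assoc, ← sq]; exact mul_mem ht hc, hd, smul_comb ..⟩

variable {s : ℂ}

theorem mul_left_mem_oddSpan (h : IsMarkedPair f w t s) (ht : t ^ 2 ∈ k) (hs : s ∈ k)
    {M : Matrix (Fin 2) (Fin 2) ℂ} (hM : M ∈ evenSpan k t f w) : M * f ∈ oddSpan k t f w := by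
  obtain ⟨a, b, c, d, ha, hb, hc, hd, rfl⟩ := hM
  refine ⟨_, _, _, _, ?_, ?_, ?_, ?_, h.comb_mul_left a b c d⟩
  · rw [show t * -(b + s * c + t * d) = -(t * b + s * (t * c) + t ^ 2 * d) by ring]
    exact neg_mem (add_mem (add_mem hb (mul_mem hs hc)) (mul_mem ht hd))
  · rw [show a + t * (b + c) + (t * t - s) * d = a + (t * b + t * c) + (t ^ 2 - s) * d by ring]
    exact add_mem (add_mem ha (add_mem hb hc)) (mul_mem (sub_mem ht hs) hd)
  · exact add_mem hc hd
  · rw [mul_neg]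
    exact neg_mem hc

theorem mul_left_mem_evenSpan (h : IsMarkedPair f w t s) (ht : t ^ 2 ∈ k) (hs : s ∈ k)
    {M : Matrix (Fin 2) (Fin 2) ℂ} (hM : M ∈ oddSpan k t f w) : M * f ∈ evenSpan k t f w := by
  obtain ⟨a, b, c, d, ha, hb, hc, hd, rfl⟩ := hM
  refine ⟨_, _, _, _, ?_, ?_, ?_, ?_, h.comb_mul_left a b c d⟩
  · exact neg_mem (add_mem (add_mem hb (mul_mem hs hc)) hd)
  · rw [show t * (a + t * (b + c) + (t * t - s) * d)
      = t * a + t ^ 2 * (b + c) + (t ^ 2 - s) * (t * d) by ring]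
    exact add_mem (add_mem ha (mul_mem ht (add_mem hb hc))) (mul_mem (sub_mem ht hs) hd)
  · rw [show t * (t * c + d) = t ^ 2 * c + t * d by ring]
    exact add_mem (mul_mem ht hc) hd
  · exact neg_mem hc

theorem mul_right_mem_oddSpan (h : IsMarkedPair f w t s) (ht : t ^ 2 ∈ k)
    {M : Matrix (Fin 2) (Fin 2) ℂ} (hM : M ∈ evenSpan k t f w) : M * w ∈ oddSpan k t f w := by
  obtain ⟨a, b, c, d, ha, hb, hc, hd, rfl⟩ := hM
  refine ⟨_, _, _, _, ?_, neg_mem hd, add_mem ha hc, ?_, h.comb_mul_right a b c d⟩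
  · rw [mul_neg]
    exact neg_mem hc
  · rw [show t * (b + t * d) = t * b + t ^ 2 * d by ring]
    exact add_mem hb (mul_mem ht hd)

theorem mul_right_mem_evenSpan (h : IsMarkedPair f w t s) (ht : t ^ 2 ∈ k)
    {M : Matrix (Fin 2) (Fin 2) ℂ} (hM : M ∈ oddSpan k t f w) : M * w ∈ evenSpan k t f w := by
  obtain ⟨a, b, c, d, ha, hb, hc, hd, rfl⟩ := hM
  refine ⟨_, _, _, _, neg_mem hc, ?_, ?_, add_mem hb hd, h.comb_mul_right a b c d⟩
  · rw [mul_neg]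
    exact neg_mem hd
  · rw [show t * (a + t * c) = t * a + t ^ 2 * c by ring]
    exact add_mem ha (mul_mem ht hc)

end Parity

section Parity

variable {k : IntermediateField ℚ ℂ} {t s : ℂ} {f w : Matrix (Fin 2) (Fin 2) ℂ}

variable (k t f w) in
/-- The elements of `SL(2, ℂ)` of even (`false`) or odd (`true`) parity: right multiplication by
them preserves, respectively exchanges, the even and the odd span. -/
def HasParity : Bool → SL(2, ℂ) → Prop
  | false, A => (∀ M ∈ evenSpan k t f w, M * A ∈ evenSpan k t f w) ∧
      ∀ M ∈ oddSpan k t f w, M * A ∈ oddSpan k t f w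
  | true, A => (∀ M ∈ evenSpan k t f w, M * A ∈ oddSpan k t f w) ∧
      ∀ M ∈ oddSpan k t f w, M * A ∈ evenSpan k t f w

theorem one_mem_evenSpan : (1 : Matrix (Fin 2) (Fin 2) ℂ) ∈ evenSpan k t f w :=
  ⟨1, 0, 0, 0, one_mem k, by simp, by simp, zero_mem k, by simp [comb]⟩

theorem hasParity_one : HasParity k t f w false 1 := by
  constructor <;> intro M hM <;> simpa using hM

theorem HasParity.mul {a b : Bool} {A B : SL(2, ℂ)} (hA : HasParity k t f w a A)
    (hB : HasParity k t f w b B) : HasParity k t f w (xor a b) (A * B) := by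
  cases a <;> cases b <;> constructor <;> intro M hM <;>
    rw [Matrix.SpecialLinearGroup.coe_mul, ← mul_assoc] <;>
    first
    | exact hB.1 _ (hA.1 _ hM)
    | exact hB.2 _ (hA.1 _ hM)
    | exact hB.1 _ (hA.2 _ hM)
    | exact hB.2 _ (hA.2 _ hM)

theorem HasParity.trace_mem (h : IsMarkedPair f w t s) (ht : t ^ 2 ∈ k) (hs : s ∈ k)
    {A : SL(2, ℂ)} (hA : HasParity k t f w false A) :
    (A : Matrix (Fin 2) (Fin 2) ℂ).trace ∈ k := by
  obtain ⟨a, b, c, d, ha, hb, hc, hd, e⟩ := hA.1 _ one_mem_evenSpan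
  rw [one_mul] at e
  rw [e, h.trace_comb]
  exact add_mem (add_mem (add_mem (mul_mem (ofNat_mem k 2) ha) hb) hc) (mul_mem (sub_mem ht hs) hd)

theorem HasParity.mul_trace_mem (h : IsMarkedPair f w t s) (ht : t ^ 2 ∈ k) (hs : s ∈ k)
    {A : SL(2, ℂ)} (hA : HasParity k t f w true A) :
    t * (A : Matrix (Fin 2) (Fin 2) ℂ).trace ∈ k := by
  obtain ⟨a, b, c, d, ha, hb, hc, hd, e⟩ := hA.1 _ one_mem_evenSpan
  rw [one_mul] at e
  rw [e, h.trace_comb, show t * (2 * a + t * b + t * c + (t ^ 2 - s) * d)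
    = 2 * (t * a) + t ^ 2 * b + t ^ 2 * c + (t ^ 2 - s) * (t * d) by ring]
  exact add_mem (add_mem (add_mem (mul_mem (ofNat_mem k 2) ha) (mul_mem ht hb)) (mul_mem ht hc))
    (mul_mem (sub_mem ht hs) hd)

theorem Matrix.SpecialLinearGroup.coe_inv_fin_two {R : Type*} [CommRing R] (A : SL(2, R)) :
    ((A⁻¹ : SL(2, R)) : Matrix (Fin 2) (Fin 2) R)
      = (A : Matrix (Fin 2) (Fin 2) R).trace • 1 - (A : Matrix (Fin 2) (Fin 2) R) := by
  rw [Matrix.SpecialLinearGroup.coe_inv, Matrix.adjugate_fin_two]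
  ext i j
  fin_cases i <;> fin_cases j <;> simp [Matrix.trace_fin_two]

/-- Since `r = (t ^ 2)⁻¹ (t r) t`, the scalar `r` is a multiple of `t` by an element of `k`, and
multiplication by `t` exchanges the spans. -/
theorem smul_mem_oddSpan_of_mul_mem (ht0 : t ≠ 0) (ht : t ^ 2 ∈ k) {r : ℂ} (hr : t * r ∈ k)
    {M : Matrix (Fin 2) (Fin 2) ℂ} (hM : M ∈ evenSpan k t f w) : r • M ∈ oddSpan k t f w := by
  have := smul_mem_oddSpan (mul_mem (inv_mem ht) hr) (smul_trace_mem_oddSpan ht hM)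
  rwa [smul_smul, show (t ^ 2)⁻¹ * (t * r) * t = r by field_simp] at this

theorem smul_mem_evenSpan_of_mul_mem (ht0 : t ≠ 0) (ht : t ^ 2 ∈ k) {r : ℂ} (hr : t * r ∈ k)
    {M : Matrix (Fin 2) (Fin 2) ℂ} (hM : M ∈ oddSpan k t f w) : r • M ∈ evenSpan k t f w := by
  have := smul_mem_evenSpan (mul_mem (inv_mem ht) hr) (smul_trace_mem_evenSpan ht hM)
  rwa [smul_smul, show (t ^ 2)⁻¹ * (t * r) * t = r by field_simp] at this

theorem neg_mem_evenSpan {M : Matrix (Fin 2) (Fin 2) ℂ} (hM : M ∈ evenSpan k t f w) :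
    -M ∈ evenSpan k t f w := by
  simpa using smul_mem_evenSpan (neg_mem (one_mem k)) hM

theorem neg_mem_oddSpan {M : Matrix (Fin 2) (Fin 2) ℂ} (hM : M ∈ oddSpan k t f w) :
    -M ∈ oddSpan k t f w := by
  simpa using smul_mem_oddSpan (neg_mem (one_mem k)) hM

/-- By Cayley–Hamilton `A⁻¹ = tr A - A`. The scalar `tr A` has the parity of `A`: it lies in `k` for
even `A`, while `t * tr A` does for odd `A`. -/
theorem HasParity.inv (h : IsMarkedPair f w t s) (ht0 : t ≠ 0) (ht : t ^ 2 ∈ k) (hs : s ∈ k)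
    {a : Bool} {A : SL(2, ℂ)} (hA : HasParity k t f w a A) : HasParity k t f w a A⁻¹ := by
  have e : ∀ M : Matrix (Fin 2) (Fin 2) ℂ,
      M * ((A⁻¹ : SL(2, ℂ)) : Matrix (Fin 2) (Fin 2) ℂ)
        = (A : Matrix (Fin 2) (Fin 2) ℂ).trace • M + -(M * (A : Matrix (Fin 2) (Fin 2) ℂ)) := by
    intro M
    rw [Matrix.SpecialLinearGroup.coe_inv_fin_two, mul_sub, mul_smul_comm, mul_one, sub_eq_add_neg]
  cases a
  · have hT := hA.trace_mem h ht hs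
    constructor <;> intro M hM <;> rw [e]
    · exact add_mem_evenSpan (smul_mem_evenSpan hT hM) (neg_mem_evenSpan (hA.1 M hM))
    · exact add_mem_oddSpan (smul_mem_oddSpan hT hM) (neg_mem_oddSpan (hA.2 M hM))
  · have hT := hA.mul_trace_mem h ht hs
    constructor <;> intro M hM <;> rw [e]
    · exact add_mem_oddSpan (smul_mem_oddSpan_of_mul_mem ht0 ht hT hM) (neg_mem_oddSpan (hA.1 M hM))
    · exact add_mem_evenSpan (smul_mem_evenSpan_of_mul_mem ht0 ht hT hM)
        (neg_mem_evenSpan (hA.2 M hM))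

end Parity

/-! ### Upper bound: the even subgroup. -/

section UpperBound

variable {k : IntermediateField ℚ ℂ} {t s : ℂ} {f w : SL(2, ℂ)}

/-- The elements of `PSL(2, ℂ)` of even parity. -/
def evenSubgroup (h : IsMarkedPair (f : Matrix (Fin 2) (Fin 2) ℂ) w t s) (ht0 : t ≠ 0)
    (ht : t ^ 2 ∈ k) (hs : s ∈ k) : Subgroup PSLTwoC :=
  Subgroup.map toPSL
    { carrier := {A | HasParity k t f w false A}
      mul_mem' := fun hA hB => HasParity.mul (a := false) (b := false) hA hB
      one_mem' := hasParity_one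
      inv_mem' := fun hA => HasParity.inv (a := false) h ht0 ht hs hA }

theorem exists_hasParity_of_mem (h : IsMarkedPair (f : Matrix (Fin 2) (Fin 2) ℂ) w t s)
    (ht0 : t ≠ 0) (ht : t ^ 2 ∈ k) (hs : s ∈ k) {x : PSLTwoC} (hx : x ∈ generatedGroup f w) :
    ∃ a A, toPSL A = x ∧ HasParity k t f w a A := by
  induction hx using Subgroup.closure_induction with
  | mem x hx =>
    rcases hx with rfl | rfl
    · exact ⟨true, f, rfl, fun M hM => mul_left_mem_oddSpan h ht hs hM,
        fun M hM => mul_left_mem_evenSpan h ht hs hM⟩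
    · exact ⟨true, w, rfl, fun M hM => mul_right_mem_oddSpan h ht hM,
        fun M hM => mul_right_mem_evenSpan h ht hM⟩
  | one => exact ⟨false, 1, map_one _, hasParity_one⟩
  | mul x y _ _ hx hy =>
    obtain ⟨a, A, rfl, hA⟩ := hx
    obtain ⟨b, B, rfl, hB⟩ := hy
    exact ⟨_, A * B, map_mul _ _ _, hA.mul hB⟩
  | inv x _ hx =>
    obtain ⟨a, A, rfl, hA⟩ := hx
    exact ⟨a, A⁻¹, map_inv _ _, hA.inv h ht0 ht hs⟩

/-- Parity need not be unique: if `t ∈ k`, the two spans coincide and every element is even. Hence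
the index is 1 or 2, and the two cases are separated. -/
theorem relIndex_evenSubgroup_ne_zero (h : IsMarkedPair (f : Matrix (Fin 2) (Fin 2) ℂ) w t s)
    (ht0 : t ≠ 0) (ht : t ^ 2 ∈ k) (hs : s ∈ k) :
    (evenSubgroup h ht0 ht hs).relIndex (generatedGroup f w) ≠ 0 := by
  by_cases hle : generatedGroup f w ≤ evenSubgroup h ht0 ht hs
  · rw [Subgroup.relIndex_eq_one.2 hle]
    exact one_ne_zero
  · obtain ⟨x, hx, hx'⟩ := SetLike.not_le_iff_exists.1 hle
    have h2 : ((evenSubgroup h ht0 ht hs).subgroupOf (generatedGroup f w)).index = 2 := by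
      refine Subgroup.index_eq_two_iff.2 ⟨⟨x, hx⟩, fun ⟨y, hy⟩ => ?_⟩
      rw [Subgroup.mem_subgroupOf, Subgroup.mem_subgroupOf, Subgroup.coe_mul]
      by_cases hyE : y ∈ evenSubgroup h ht0 ht hs
      · exact Or.inr ⟨hyE, fun hyx => hx' ((Subgroup.mul_mem_cancel_left _ hyE).1 hyx)⟩
      · refine Or.inl ⟨?_, hyE⟩
        obtain ⟨a, A, rfl, hA⟩ := exists_hasParity_of_mem h ht0 ht hs hx
        obtain ⟨b, B, rfl, hB⟩ := exists_hasParity_of_mem h ht0 ht hs hy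
        cases a
        · exact absurd ⟨A, hA, rfl⟩ hx'
        cases b
        · exact absurd ⟨B, hB, rfl⟩ hyE
        exact ⟨B * A, HasParity.mul (a := true) (b := true) hB hA, map_mul _ _ _⟩
    rw [Subgroup.relIndex, h2]
    exact two_ne_zero

theorem traceField_evenSubgroup_le (h : IsMarkedPair (f : Matrix (Fin 2) (Fin 2) ℂ) w t s)
    (ht0 : t ≠ 0) (ht : t ^ 2 ∈ k) (hs : s ∈ k) :
    traceField (evenSubgroup h ht0 ht hs) ≤ k := by
  refine IntermediateField.adjoin_le_iff.2 ?_
  rintro _ ⟨A, ⟨B, hB, hBA⟩, rfl⟩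
  have hT := HasParity.trace_mem h ht hs hB
  rcases eq_or_eq_neg_of_toPSL_eq hBA with rfl | rfl
  · exact hT
  · simpa using hT

end UpperBound

/-- The invariant trace field of the group generated by two loxodromic elements `f`, `w` with
`tr f = tr w = t` and `tr (f⁻¹ w) = s` that generate an irreducible group. -/
theorem invariantTraceField_generatedGroup {f w : SL(2, ℂ)} {z t s : ℂ}
    (h : IsMarkedPair (f : Matrix (Fin 2) (Fin 2) ℂ) w t s) (hz : 1 < ‖z‖)
    (hzt : z * t = z ^ 2 + 1) (hs : s ≠ 2) (hts : s ≠ t ^ 2 - 2) (ht0 : t ≠ 0) :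
    invariantTraceField (generatedGroup f w) = IntermediateField.adjoin ℚ {t ^ 2, s} := by
  apply le_antisymm
  · have ht' : t ^ 2 ∈ IntermediateField.adjoin ℚ {t ^ 2, s} :=
      IntermediateField.subset_adjoin ℚ _ (by simp)
    have hs' : s ∈ IntermediateField.adjoin ℚ {t ^ 2, s} :=
      IntermediateField.subset_adjoin ℚ _ (by simp)
    -- The even elements are taken in all of `PSL(2, ℂ)`, so they are intersected with the group to
    -- obtain an admissible `H`.
    refine le_trans (sInf_le ⟨evenSubgroup h ht0 ht' hs' ⊓ generatedGroup f w, inf_le_right, ?_,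
      rfl⟩) ((traceField_mono inf_le_left).trans (traceField_evenSubgroup_le h ht0 ht' hs'))
    rw [Subgroup.inf_relIndex_right]
    exact relIndex_evenSubgroup_ne_zero h ht0 ht' hs'
  · refine le_sInf ?_
    rintro _ ⟨H, -, hH, rfl⟩
    have hfG : toPSL f ∈ generatedGroup f w := Subgroup.subset_closure (by simp)
    have hwG : toPSL w ∈ generatedGroup f w := Subgroup.subset_closure (by simp)
    have hD : gramDisc (f : Matrix (Fin 2) (Fin 2) ℂ) (w : Matrix (Fin 2) (Fin 2) ℂ) ≠ 0 := by
      rw [h.gramDisc_eq]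
      exact mul_ne_zero (by norm_num) (mul_ne_zero (sub_ne_zero.2 hs) (sub_ne_zero.2 hts.symm))
    have hsq : ∀ g : SL(2, ℂ), toPSL g ∈ generatedGroup f w →
        (g : Matrix (Fin 2) (Fin 2) ℂ).trace ^ 2 ∈ traceField H := fun g hg =>
      trace_sq_mem_traceField_of_finiteIndex hz hzt h.trace_left h.trace_right hD hfG hwG hH hg
    have h1 := hsq f hfG
    have h2 := hsq (f * w) (by rw [map_mul]; exact mul_mem hfG hwG)
    have h3 := hsq (f⁻¹ * w) (by rw [map_mul, map_inv]; exact mul_mem (inv_mem hfG) hwG)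
    have e : ((f⁻¹ * w : SL(2, ℂ)) : Matrix (Fin 2) (Fin 2) ℂ).trace = s := by
      rw [Matrix.SpecialLinearGroup.coe_mul, Matrix.SpecialLinearGroup.coe_inv_fin_two, sub_mul,
        smul_mul_assoc, one_mul, Matrix.trace_sub, Matrix.trace_smul, h.trace_left, h.trace_right,
        h.trace_mul, smul_eq_mul]
      ring
    rw [Matrix.SpecialLinearGroup.coe_mul, h.trace_mul] at h2
    rw [e] at h3
    rw [h.trace_left] at h1
    -- The squares of `t ^ 2 - s` and `s` determine `s`, because `t ^ 4 + s ^ 2 - (t ^ 2 - s) ^ 2 =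
    -- 2 t ^ 2 s` and `t ≠ 0`.
    have h4 : s ∈ traceField H := by
      have := mul_mem (inv_mem (mul_mem (ofNat_mem (traceField H) 2) h1))
        (sub_mem (add_mem (pow_mem h1 2) h3) h2)
      rwa [show (2 * t ^ 2)⁻¹ * ((t ^ 2) ^ 2 + s ^ 2 - (t ^ 2 - s) ^ 2) = s by
        field_simp; ring] at this
    refine IntermediateField.adjoin_le_iff.2 ?_
    rintro x (rfl | rfl)
    · exact h1
    · exact h4

/-! ### Coefficient lists and an irreducibility criterion. -/

theorem Multiset.lt_prod_of_forall_lt {m : ℝ} (hm : 1 ≤ m) (s : Multiset ℝ) (hs : s ≠ 0)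
    (h : ∀ x ∈ s, m < x) : m < s.prod := by
  have h1 : ∀ s : Multiset ℝ, (∀ x ∈ s, m < x) → 1 ≤ s.prod := by
    intro s
    induction s using Multiset.induction_on with
    | empty => simp
    | cons a s ih =>
      intro h
      rw [Multiset.prod_cons]
      exact one_le_mul_of_one_le_of_one_le (hm.trans (h a (by simp)).le)
        (ih fun x hx => h x (by simp [hx]))
  obtain ⟨a, ha⟩ := Multiset.exists_mem_of_ne_zero hs
  obtain ⟨s, rfl⟩ := Multiset.exists_cons_of_mem ha
  rw [Multiset.prod_cons]
  have ha' := h a ha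
  have := h1 s fun x hx => h x (by simp [hx])
  nlinarith

/-- The polynomial with the given list of coefficients, the constant one first. -/
noncomputable def listPoly : List ℚ → ℚ[X]
  | [] => 0
  | a :: l => C a + X * listPoly l

/-- The value of `listPoly l` at `x`. -/
def listEval (x : ℂ) : List ℚ → ℂ
  | [] => 0
  | a :: l => a + x * listEval x l

/-- The value of the derivative of `listPoly l` at `x`. -/
def listDeriv (x : ℂ) : List ℚ → ℂ
  | [] => 0
  | _ :: l => listEval x l + x * listDeriv x l

theorem aeval_listPoly (x : ℂ) (l : List ℚ) : aeval x (listPoly l) = listEval x l := by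
  induction l with
  | nil => simp [listPoly, listEval]
  | cons a l ih => simp [listPoly, listEval, ih]

theorem aeval_derivative_listPoly (x : ℂ) (l : List ℚ) :
    aeval x (derivative (listPoly l)) = listDeriv x l := by
  induction l with
  | nil => simp [listPoly, listDeriv]
  | cons a l ih => simp [listPoly, listDeriv, ih, aeval_listPoly]

theorem natDegree_listPoly_le (l : List ℚ) : (listPoly l).natDegree ≤ l.length := by
  induction l with
  | nil => simp [listPoly]
  | cons a l ih =>
    refine (natDegree_C_add).le.trans ((natDegree_mul_le).trans ?_)
    rw [natDegree_X, List.length_cons]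
    omega

/-- A bound of the polynomial with coefficients `l` on the disc of radius `r`. -/
def listBound (r : ℚ) : List ℚ → ℚ
  | [] => 0
  | a :: l => |a| + r * listBound r l

/-- A Lipschitz constant of the polynomial with coefficients `l` on the disc of radius `r`. -/
def listLipschitz (r : ℚ) : List ℚ → ℚ
  | [] => 0
  | _ :: l => listBound r l + r * listLipschitz r l

/-- A bound of the quadratic remainder of the polynomial with coefficients `l` on the disc of
radius `r`. -/
def listTaylor (r : ℚ) : List ℚ → ℚ
  | [] => 0
  | _ :: l => listLipschitz r l + r * listTaylor r l

theorem listBound_nonneg {r : ℚ} (hr : 0 ≤ r) (l : List ℚ) : 0 ≤ listBound r l := by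
  induction l with
  | nil => simp [listBound]
  | cons a l ih => rw [listBound]; positivity

theorem listLipschitz_nonneg {r : ℚ} (hr : 0 ≤ r) (l : List ℚ) : 0 ≤ listLipschitz r l := by
  induction l with
  | nil => simp [listLipschitz]
  | cons a l ih => have := listBound_nonneg hr l; rw [listLipschitz]; positivity

theorem listTaylor_nonneg {r : ℚ} (hr : 0 ≤ r) (l : List ℚ) : 0 ≤ listTaylor r l := by
  induction l with
  | nil => simp [listTaylor]
  | cons a l ih => have := listLipschitz_nonneg hr l; rw [listTaylor]; positivity

theorem norm_listEval_le {r : ℚ} {x : ℂ} (hx : ‖x‖ ≤ r) (l : List ℚ) :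
    ‖listEval x l‖ ≤ listBound r l := by
  induction l with
  | nil => simp [listEval, listBound]
  | cons a l ih =>
    have ha : ‖(a : ℂ)‖ = |(a : ℝ)| := by
      rw [← Real.norm_eq_abs, ← Complex.norm_real, Complex.ofReal_ratCast]
    refine (norm_add_le _ _).trans ?_
    rw [norm_mul, ha, listBound]
    push_cast
    gcongr
    exact (norm_nonneg x).trans hx

theorem norm_listEval_sub_le {r : ℚ} {x y : ℂ} (hx : ‖x‖ ≤ r) (hy : ‖y‖ ≤ r) (l : List ℚ) :
    ‖listEval x l - listEval y l‖ ≤ listLipschitz r l * ‖x - y‖ := by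
  have hr : 0 ≤ (r : ℝ) := (norm_nonneg x).trans hx
  induction l with
  | nil => simp [listEval, listLipschitz]
  | cons a l ih =>
    rw [listEval, listEval, listLipschitz, show (a + x * listEval x l - (a + y * listEval y l) : ℂ)
      = listEval x l * (x - y) + y * (listEval x l - listEval y l) by ring]
    refine (norm_add_le _ _).trans ?_
    rw [norm_mul, norm_mul]
    push_cast
    rw [add_mul, mul_assoc]
    gcongr
    exact norm_listEval_le hx l

theorem norm_listEval_sub_sub_le {r : ℚ} {x y : ℂ} (hx : ‖x‖ ≤ r) (hy : ‖y‖ ≤ r) (l : List ℚ) :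
    ‖listEval x l - listEval y l - listDeriv y l * (x - y)‖ ≤ listTaylor r l * ‖x - y‖ ^ 2 := by
  have hr : 0 ≤ (r : ℝ) := (norm_nonneg x).trans hx
  induction l with
  | nil => simp [listEval, listDeriv, listTaylor]
  | cons a l ih =>
    rw [listEval, listEval, listDeriv, listTaylor,
      show (a + x * listEval x l - (a + y * listEval y l)
        - (listEval y l + y * listDeriv y l) * (x - y) : ℂ)
      = (listEval x l - listEval y l) * (x - y)
        + y * (listEval x l - listEval y l - listDeriv y l * (x - y)) by ring]
    refine (norm_add_le _ _).trans ?_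
    rw [norm_mul, norm_mul]
    push_cast
    rw [add_mul, mul_assoc, sq ‖x - y‖, ← mul_assoc, ← sq]
    gcongr
    exact norm_listEval_sub_le hx hy l

/-- A monic integer polynomial of which no complex root is within `m ≥ 1` of the integer `n` is
irreducible if its value at `n` is, up to sign, `m` times a prime. -/
theorem Polynomial.Monic.irreducible_of_eval_eq_mul_prime {p : ℤ[X]} (hp : p.Monic) (hp1 : p ≠ 1)
    {n : ℤ} {m q : ℕ} (hm : 1 ≤ m) (hq : q.Prime) (hpn : (p.eval n).natAbs = m * q)
    (hroot : ∀ x : ℂ, aeval x p = 0 → (m : ℝ) < ‖(n : ℂ) - x‖) : Irreducible p := by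
  -- For a monic nonconstant factor `g`, `|g(n)|` is the product of the distances from `n` to the
  -- roots of `g`, each greater than `m`.
  have key : ∀ g : ℤ[X], g.Monic → g ∣ p → g.natDegree ≠ 0 → m < (g.eval n).natAbs := by
    intro g hg hgp hdeg
    have hgC : (g.map (Int.castRingHom ℂ)).Monic := hg.map _
    have hsplit := IsAlgClosed.splits (g.map (Int.castRingHom ℂ))
    have h1 := hsplit.eval_eq_prod_roots_of_monic hgC (n : ℂ)
    have h2 : (g.map (Int.castRingHom ℂ)).eval (n : ℂ) = ((g.eval n : ℤ) : ℂ) := by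
      simp [eval_map, eval₂_at_intCast]
    have h3 : ((g.eval n).natAbs : ℝ) = ‖(((g.eval n) : ℤ) : ℂ)‖ := by
      rw [Complex.norm_intCast, Nat.cast_natAbs, Int.cast_abs]
    rw [← @Nat.cast_lt ℝ, h3, ← h2, h1]
    change (m : ℝ) < (normHom : ℂ →*₀ ℝ) _
    rw [map_multiset_prod, Multiset.map_map]
    refine Multiset.lt_prod_of_forall_lt (by exact_mod_cast hm) _ ?_ ?_
    · rw [Ne, Multiset.map_eq_zero, ← Multiset.card_eq_zero, ← hsplit.natDegree_eq_card_roots,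
        hg.natDegree_map]
      exact hdeg
    · intro r hr
      obtain ⟨x, hx, rfl⟩ := Multiset.mem_map.1 hr
      refine hroot x ?_
      obtain ⟨h, rfl⟩ := hgp
      have : aeval x g = 0 := by
        have := isRoot_of_mem_roots hx
        rwa [IsRoot, eval_map, ← algebraMap_int_eq, ← aeval_def] at this
      rw [map_mul, this, zero_mul]
  rw [hp.irreducible_iff_natDegree, and_iff_right hp1]
  intro g h hg hh hgh
  by_contra! hdeg
  have h1 := key g hg ⟨h, hgh.symm⟩ hdeg.1
  have h2 := key h hh ⟨g, by rw [mul_comm, hgh]⟩ hdeg.2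
  rw [← hgh, eval_mul, Int.natAbs_mul] at hpn
  -- The prime `q` divides one of the two values; the other then divides `m`, which is too small.
  have hle : ∀ a b : ℕ, m < a → m < b → a * b = m * q → q ∣ a → False := by
    rintro _ b ha hb hab ⟨c, rfl⟩
    have hc : c ≠ 0 := by rintro rfl; simp at ha
    have : c * b = m := by
      have := hq.pos
      apply Nat.eq_of_mul_eq_mul_left this
      rw [← mul_assoc, hab, mul_comm]
    have := Nat.le_mul_of_pos_left b (Nat.pos_of_ne_zero hc)
    omega
  rcases hq.dvd_mul.1 (hpn ▸ Dvd.intro_left m rfl) with hd | hd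
  · exact hle _ _ h1 h2 hpn hd
  · exact hle _ _ h2 h1 (by rw [mul_comm, hpn]) hd

/-- The criterion `Polynomial.Monic.irreducible_of_eval_eq_mul_prime`, with the condition on the
roots read off the Taylor coefficients at `n`. -/
theorem Polynomial.Monic.irreducible_map_of_taylor {p : ℤ[X]} (hp : p.Monic) (hp1 : p ≠ 1)
    (n c : ℤ) (m q : ℕ) (cs : List ℚ) (hm : 1 ≤ m) (hq : q.Prime) (hc : c.natAbs = m * q)
    (hbd : m * listBound m cs < |(c : ℚ)|)
    (htaylor : ∀ x : ℂ, aeval x p = c + (x - n) * listEval (x - n) cs) :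
    Irreducible (p.map (algebraMap ℤ ℚ)) := by
  refine (hp.irreducible_iff_irreducible_map_fraction_map).1
    (hp.irreducible_of_eval_eq_mul_prime (n := n) hp1 hm hq ?_ ?_)
  · have := htaylor n
    rw [sub_self, zero_mul, add_zero] at this
    have h2 : aeval (n : ℂ) p = ((p.eval n : ℤ) : ℂ) := by
      rw [aeval_def, algebraMap_int_eq, eval₂_at_intCast]; simp
    rw [h2] at this
    rw [Int.cast_injective this, hc]
  · intro x hx
    rw [htaylor] at hx
    -- At a root with `|x - n| ≤ m` the nonconstant Taylor terms would have to cancel `c`, but their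
    -- sum is smaller than `|c|`.
    by_contra! hle
    rw [norm_sub_rev] at hle
    have h1 := norm_listEval_le (r := m) (by simpa using hle) cs
    have h2 : ‖(c : ℂ)‖ = ‖x - n‖ * ‖listEval (x - n) cs‖ := by
      rw [← norm_mul, eq_neg_of_add_eq_zero_left hx, norm_neg]
    rw [Complex.norm_intCast] at h2
    have h3 : (m : ℝ) * listBound m cs < |(c : ℝ)| := by exact_mod_cast hbd
    have := mul_le_mul hle h1 (norm_nonneg _) (by positivity)
    linarith

/-- Lucas test with base 2, based on the factorisation of the predecessor. -/
theorem prime_3062130595354603 : Nat.Prime 3062130595354603 := by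
  refine lucas_primality _ (2 : ZMod 3062130595354603) (by reduce_mod_char) fun q hq hd => ?_
  have h : q ∣ 2 * (3 ^ 2 * (17 * (19 * (532919 * 988297)))) := by norm_num at hd ⊢; exact hd
  have e : ∀ {r : ℕ}, r.Prime → q ∣ r → q = r :=
    fun hr h => (Nat.prime_dvd_prime_iff_eq hq hr).1 h
  have : q = 2 ∨ q = 3 ∨ q = 17 ∨ q = 19 ∨ q = 532919 ∨ q = 988297 := by
    rw [hq.dvd_mul, hq.dvd_mul, hq.dvd_mul, hq.dvd_mul, hq.dvd_mul] at h
    rcases h with h | h | h | h | h | h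
    · exact Or.inl (e Nat.prime_two h)
    · exact Or.inr (Or.inl (e Nat.prime_three (hq.dvd_of_dvd_pow h)))
    · simp [e (by norm_num) h]
    · simp [e (by norm_num) h]
    · simp [e (by norm_num) h]
    · simp [e (by norm_num) h]
  rcases this with rfl | rfl | rfl | rfl | rfl | rfl <;> reduce_mod_char <;> decide

/-- Here and below the arguments are the integer `n`, the value `c` there, its splitting `m * q`,
and the remaining Taylor coefficients at `n`. -/
theorem irreducible_fieldPoly_0 : Irreducible (fieldPoly 0) := by
  have hp : (X ^ 2 + 3 : ℤ[X]).Monic := by monicity!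
  have hdeg : (X ^ 2 + 3 : ℤ[X]).natDegree = 2 := by compute_degree!
  have h := hp.irreducible_map_of_taylor (fun h => by simp [h] at hdeg) (0) (3) 1 3 [0, 1]
    (by norm_num) (by norm_num) (by norm_num) (by norm_num [listBound])
    (fun x => by simp [listEval, aeval_def, eval₂_ofNat]; ring)
  simpa [fieldPoly] using h

theorem irreducible_fieldPoly_1 : Irreducible (fieldPoly 1) := by
  have hp : (X ^ 4 - 2 * X ^ 3 + X ^ 2 - 2 * X + 1 : ℤ[X]).Monic := by monicity!
  have hdeg : (X ^ 4 - 2 * X ^ 3 + X ^ 2 - 2 * X + 1 : ℤ[X]).natDegree = 4 := by compute_degree!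
  have h := hp.irreducible_map_of_taylor (fun h => by simp [h] at hdeg) (-5) (911) 1 911 [-662,
    181, -22, 1]
    (by norm_num) (by norm_num) (by norm_num) (by norm_num [listBound])
    (fun x => by simp [listEval, aeval_def, eval₂_ofNat]; ring)
  simpa [fieldPoly] using h

theorem irreducible_fieldPoly_2 : Irreducible (fieldPoly 2) := by
  have hp : (X ^ 2 + 1 : ℤ[X]).Monic := by monicity!
  have hdeg : (X ^ 2 + 1 : ℤ[X]).natDegree = 2 := by compute_degree!
  have h := hp.irreducible_map_of_taylor (fun h => by simp [h] at hdeg) (-4) (17) 1 17 [-8, 1]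
    (by norm_num) (by norm_num) (by norm_num) (by norm_num [listBound])
    (fun x => by simp [listEval, aeval_def]; ring)
  simpa [fieldPoly] using h

theorem irreducible_fieldPoly_3 : Irreducible (fieldPoly 3) := by
  have hp : (X ^ 12 + 6 * X ^ 11 + 23 * X ^ 10 + 91 * X ^ 9 + 257 * X ^ 8 + 489 * X ^ 7 + 823 * X
      ^ 6 + 1054 * X ^ 5 - 13 * X ^ 4 - 2445 * X ^ 3 - 3405 * X ^ 2 - 1847 * X - 337 : ℤ[X]).Monic
      := by monicity!
  have hdeg : (X ^ 12 + 6 * X ^ 11 + 23 * X ^ 10 + 91 * X ^ 9 + 257 * X ^ 8 + 489 * X ^ 7 + 823 *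
      X ^ 6 + 1054 * X ^ 5 - 13 * X ^ 4 - 2445 * X ^ 3 - 3405 * X ^ 2 - 1847 * X - 337 :
      ℤ[X]).natDegree = 12 := by compute_degree!
  have h := hp.irreducible_map_of_taylor (fun h => by simp [h] at hdeg) (-20) (3062130595354603) 1
    3062130595354603 [-1880981168783647, 529612294192095, -90383027465405, 10412775112587,
    -853175766106, 50980058763, -2238410231, 71677877, -1632509, 25103, -234, 1]
    (by norm_num) prime_3062130595354603 (by norm_num) (by norm_num [listBound])
    (fun x => by simp [listEval, aeval_def, eval₂_ofNat]; ring)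
  simpa [fieldPoly] using h

/-- All values of this polynomial at integers are even, so `m = 1` would leave only the prime 2.
With `m = 2` an odd prime is available. -/
theorem irreducible_fieldPoly_4 : Irreducible (fieldPoly 4) := by
  have hp : (X ^ 3 - X - 2 : ℤ[X]).Monic := by monicity!
  have hdeg : (X ^ 3 - X - 2 : ℤ[X]).natDegree = 3 := by compute_degree!
  have h := hp.irreducible_map_of_taylor (fun h => by simp [h] at hdeg) (53) (148822) 2 74411
    [8426, 159, 1]
    (by norm_num) (by norm_num) (by norm_num) (by norm_num [listBound])
    (fun x => by simp [listEval, aeval_def, eval₂_ofNat]; ring)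
  simpa [fieldPoly] using h

theorem irreducible_fieldPoly_5 : Irreducible (fieldPoly 5) := by
  have hp : (X ^ 3 - X ^ 2 + X + 1 : ℤ[X]).Monic := by monicity!
  have hdeg : (X ^ 3 - X ^ 2 + X + 1 : ℤ[X]).natDegree = 3 := by compute_degree!
  have h := hp.irreducible_map_of_taylor (fun h => by simp [h] at hdeg) (-4) (-83) 1 83 [57, -13,
    1]
    (by norm_num) (by norm_num) (by norm_num) (by norm_num [listBound])
    (fun x => by simp [listEval, aeval_def]; ring)
  simpa [fieldPoly] using h

theorem irreducible_fieldPoly (i : Fin 7) : Irreducible (fieldPoly i) := by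
  fin_cases i
  exacts [irreducible_fieldPoly_0, irreducible_fieldPoly_1, irreducible_fieldPoly_2,
    irreducible_fieldPoly_3, irreducible_fieldPoly_4, irreducible_fieldPoly_5,
    irreducible_fieldPoly_5]

theorem monic_fieldPoly (i : Fin 7) : (fieldPoly i).Monic := by
  fin_cases i <;> simp only [fieldPoly] <;> monicity!

/-! ### Location of roots -/

/-- The complex number with given rational real and imaginary parts. -/
def gauss (v : ℚ × ℚ) : ℂ := ⟨v.1, v.2⟩

def gaussMul (u v : ℚ × ℚ) : ℚ × ℚ := (u.1 * v.1 - u.2 * v.2, u.1 * v.2 + u.2 * v.1)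

/-- The values at `v` of the polynomial with coefficients `l` and of its derivative. -/
def gaussHorner (v : ℚ × ℚ) : List ℚ → (ℚ × ℚ) × (ℚ × ℚ)
  | [] => ((0, 0), (0, 0))
  | a :: l =>
    let r := gaussHorner v l
    let p := gaussMul v r.1
    ((a + p.1, p.2), r.1 + gaussMul v r.2)

def gaussNormSq (v : ℚ × ℚ) : ℚ := v.1 ^ 2 + v.2 ^ 2

theorem gauss_mul (u v : ℚ × ℚ) : gauss (gaussMul u v) = gauss u * gauss v := by
  apply Complex.ext <;> simp [gauss, gaussMul]

theorem gauss_add (u v : ℚ × ℚ) : gauss (u + v) = gauss u + gauss v := by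
  apply Complex.ext <;> simp [gauss]

theorem gauss_sub (u v : ℚ × ℚ) : gauss (u - v) = gauss u - gauss v := by
  apply Complex.ext <;> simp [gauss]

theorem norm_gauss_sq (v : ℚ × ℚ) : ‖gauss v‖ ^ 2 = gaussNormSq v := by
  rw [← Complex.normSq_eq_norm_sq, Complex.normSq_apply, gauss, gaussNormSq]
  push_cast
  ring

theorem norm_gauss_le {v : ℚ × ℚ} {r : ℚ} (hr : 0 ≤ r) (h : gaussNormSq v ≤ r ^ 2) :
    ‖gauss v‖ ≤ r := by
  have : ‖gauss v‖ ^ 2 ≤ (r : ℝ) ^ 2 := by rw [norm_gauss_sq]; exact_mod_cast h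
  exact le_of_sq_le_sq this (by exact_mod_cast hr)

theorem le_norm_gauss {v : ℚ × ℚ} {r : ℚ} (h : r ^ 2 ≤ gaussNormSq v) : r ≤ ‖gauss v‖ := by
  have : (r : ℝ) ^ 2 ≤ ‖gauss v‖ ^ 2 := by rw [norm_gauss_sq]; exact_mod_cast h
  exact le_of_sq_le_sq this (norm_nonneg _)

theorem gauss_gaussHorner (v : ℚ × ℚ) (l : List ℚ) :
    gauss (gaussHorner v l).1 = listEval (gauss v) l ∧
      gauss (gaussHorner v l).2 = listDeriv (gauss v) l := by
  induction l with
  | nil => constructor <;> simp [gaussHorner, listEval, listDeriv, gauss, Complex.ext_iff]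
  | cons a l ih =>
    rw [gaussHorner, listEval, listDeriv, ← ih.1, ← ih.2, ← gauss_mul, ← gauss_mul, ← gauss_add]
    exact ⟨by apply Complex.ext <;> simp [gauss], rfl⟩

/-- A polynomial of degree at most `n` has a root within `n * |p(x)| / |p'(x)|` of `x`. -/
theorem exists_root_norm_sub_le (l : List ℚ) (x : ℂ) {δ : ℝ} (hδ : 0 < δ)
    (h : l.length * ‖listEval x l‖ < δ * ‖listDeriv x l‖) :
    ∃ z, listEval z l = 0 ∧ ‖z - x‖ ≤ δ := by
  by_cases hx : listEval x l = 0
  · exact ⟨x, hx, by simpa using hδ.le⟩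
  by_contra! hfar
  set p : ℂ[X] := (listPoly l).map (algebraMap ℚ ℂ) with hp
  have hpe : ∀ y, p.eval y = listEval y l := fun y => by
    rw [hp, eval_map_algebraMap, aeval_listPoly]
  have hpd : p.derivative.eval x = listDeriv x l := by
    rw [hp, derivative_map, eval_map_algebraMap, aeval_derivative_listPoly]
  -- The logarithmic derivative `p' / p` is the sum of `1 / (x - z)` over the roots; were they all
  -- farther than `δ`, it would be at most `n / δ`.
  have key := (IsAlgClosed.splits p).eval_derivative_eq_eval_mul_sum (x := x) (by rwa [hpe])
  have hsum : ‖(p.roots.map fun z => 1 / (x - z)).sum‖ ≤ l.length * δ⁻¹ := by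
    refine (norm_multiset_sum_le _).trans ?_
    refine (Multiset.sum_le_card_nsmul _ δ⁻¹ ?_).trans ?_
    · intro y hy
      simp only [Multiset.mem_map, exists_exists_and_eq_and] at hy
      obtain ⟨z, hz, rfl⟩ := hy
      rw [norm_div, norm_one, one_div, norm_sub_rev]
      refine inv_anti₀ hδ (hfar z ?_).le
      rw [← hpe]
      exact isRoot_of_mem_roots hz
    · rw [Multiset.card_map, Multiset.card_map, nsmul_eq_mul]
      gcongr
      exact (card_roots' p).trans ((natDegree_map_le).trans (natDegree_listPoly_le l))
  rw [hpd, hpe] at key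
  rw [key, norm_mul] at h
  have hpos : 0 < ‖listEval x l‖ := norm_pos_iff.2 hx
  have : δ * (‖listEval x l‖ * ‖(p.roots.map fun z => 1 / (x - z)).sum‖)
      ≤ δ * (‖listEval x l‖ * (l.length * δ⁻¹)) := by gcongr
  rw [show δ * (‖listEval x l‖ * (l.length * δ⁻¹)) = l.length * ‖listEval x l‖ by
    field_simp] at this
  linarith

/-- A root in a disc where the linear term dominates the quadratic remainder is close to the
centre. -/
theorem norm_sub_le_of_root (l : List ℚ) {x z : ℂ} {r δ : ℝ} {R : ℚ} (hx : ‖x‖ + r ≤ R)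
    (hz : listEval z l = 0) (hzr : ‖z - x‖ ≤ r)
    (h : ‖listEval x l‖ < δ * (‖listDeriv x l‖ - listTaylor R l * r)) (hδ : 0 < δ) :
    ‖z - x‖ ≤ δ := by
  have hr : 0 ≤ r := (norm_nonneg _).trans hzr
  have hzR : ‖z‖ ≤ R := by
    have := norm_add_le (z - x) x
    rw [sub_add_cancel] at this
    linarith
  have hR : (0 : ℝ) ≤ R := (norm_nonneg _).trans hzR
  have h1 := norm_listEval_sub_sub_le hzR (by linarith : ‖x‖ ≤ R) l
  have hT : (0 : ℝ) ≤ listTaylor R l := by exact_mod_cast listTaylor_nonneg (by exact_mod_cast hR) l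
  have h2 : ‖listDeriv x l‖ * ‖z - x‖ ≤ ‖listEval x l‖ + listTaylor R l * ‖z - x‖ ^ 2 := by
    rw [← norm_mul, show listDeriv x l * (z - x) = -listEval x l
      - (listEval z l - listEval x l - listDeriv x l * (z - x)) by rw [hz]; ring]
    refine (norm_sub_le _ _).trans ?_
    rw [norm_neg]
    gcongr
  have h3 : listTaylor R l * ‖z - x‖ ^ 2 ≤ listTaylor R l * r * ‖z - x‖ := by
    rw [sq, ← mul_assoc]
    gcongr
  have hpos : 0 < ‖listDeriv x l‖ - listTaylor R l * r :=
    pos_of_mul_pos_right ((norm_nonneg _).trans_lt h) hδ.le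
  refine le_of_mul_le_mul_right ?_ hpos
  nlinarith

/-! ### Arithmetic of coefficient lists -/

def listAdd : List ℚ → List ℚ → List ℚ
  | [], m => m
  | l, [] => l
  | a :: l, b :: m => (a + b) :: listAdd l m

def listScale (c : ℚ) (l : List ℚ) : List ℚ := l.map (c * ·)

def listMul : List ℚ → List ℚ → List ℚ
  | [], _ => []
  | a :: l, m => listAdd (listScale a m) (0 :: listMul l m)

theorem listEval_listAdd (x : ℂ) (l m : List ℚ) :
    listEval x (listAdd l m) = listEval x l + listEval x m := by
  induction l, m using listAdd.induct with
  | case1 m => simp [listAdd, listEval]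
  | case2 l => cases l <;> simp [listAdd, listEval]
  | case3 a l b m ih => simp only [listAdd, listEval, ih]; push_cast; ring

theorem listEval_listScale (x : ℂ) (c : ℚ) (l : List ℚ) :
    listEval x (listScale c l) = c * listEval x l := by
  induction l with
  | nil => simp [listScale, listEval]
  | cons a l ih =>
    rw [listScale, List.map_cons, listEval, listEval, ← listScale, ih]; push_cast; ring

theorem listEval_listMul (x : ℂ) (l m : List ℚ) :
    listEval x (listMul l m) = listEval x l * listEval x m := by
  induction l with
  | nil => simp [listMul, listEval]
  | cons a l ih =>
    rw [listMul, listEval_listAdd, listEval_listScale, listEval, listEval, ih]; push_cast; ring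

/-! ### Numerical data of the marked groups -/

/-- The coefficients of `markedPoly`. -/
def markedList : Fin 7 → List ℚ
  | 0 => [1, 0, 2, 0, 6, 0, 2, 0, 1]
  | 1 => [1, -2, 5, -4, 7, -4, 5, -2, 1]
  | 2 => [1, -2, 4, -2, 1]
  | 3 => [1, -8, 35, -107, 261, -538, 972, -1565, 2282, -3034, 3706, -4171, 4339, -4171, 3706,
      -3034, 2282, -1565, 972, -538, 261, -107, 35, -8, 1]
  | 4 => [1, -3, 5, -4, 5, -3, 1]
  | 5 => [1, 0, 2, 0, 7, 0, -4, 0, 7, 0, 2, 0, 1]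
  | 6 => [1, 0, -2, 0, 7, 0, 4, 0, 7, 0, -2, 0, 1]

/-- The coefficients of the polynomial giving the generator of the invariant trace field in terms
of `z`. -/
def tauList : Fin 7 → List ℚ
  | 0 => [1, 0, 5, 0, 2, 0, 1]
  | 1 => [-1, 4, -4, 7, -4, 5, -2, 1]
  | 2 => [-1, 3, -2, 1]
  | 3 => listAdd [-2] (listMul [8, -34, 107, -261, 538, -972, 1565, -2282, 3034, -3706, 4171,
      -4339, 4171, -3706, 3034, -2282, 1565, -972, 538, -261, 107, -35, 8, -1]
      [8, -34, 107, -261, 538, -972, 1565, -2282, 3034, -3706, 4171, -4339, 4171, -3706, 3034,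
      -2282, 1565, -972, 538, -261, 107, -35, 8, -1])
  | 4 => [-2, 4, -4, 5, -3, 1]
  | 5 => [1, 0, 3, 0, -2, 0, 7/2, 0, 1, 0, 1/2]
  | 6 => [1, 0, -3, 0, -2, 0, -7/2, 0, 1, 0, -1/2]

/-- An approximation of the parameter `z`. -/
def markedCentre : Fin 7 → ℚ × ℚ
  | 0 => (853230696696365819842907106218132085749049809 / 10 ^ 45,
      -1252448658070091287903617719492583284980015203 / 10 ^ 45)
  | 1 => (904047195713429435001656033833521249903498570 / 10 ^ 45,
      -1471654223592238098673571391755282888555835847 / 10 ^ 45)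
  | 2 => (742934135878322839091431937947266281096242992 / 10 ^ 45,
      -1529085513635746125160990523790225210619365050 / 10 ^ 45)
  | 3 => (1404292212324886160678175784438326234914366157 / 10 ^ 45,
      -1179267297656976882827409344556527525394099586 / 10 ^ 45)
  | 4 => (1354619901468891950804861034191318695574068816 / 10 ^ 45,
      -1225125453962854059632648277116373043965297372 / 10 ^ 45)
  | 5 => (868063287033412642542650785475190996596797044 / 10 ^ 45,
      -1460023666194658125368309529478588517031807952 / 10 ^ 45)
  | 6 => (1460023666194658125368309529478588517031807952 / 10 ^ 45,
      -868063287033412642542650785475190996596797044 / 10 ^ 45)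

/-- A lower bound of the derivative of `markedPoly` at `markedCentre`. -/
def markedSlope : Fin 7 → ℚ
  | 0 => 63
  | 1 => 58
  | 2 => 7
  | 3 => 82847
  | 4 => 25
  | 5 => 1343
  | 6 => 1343

/-- The tabulated value of `z`. -/
def markedTable : Fin 7 → ℚ × ℚ
  | 0 => (0.853230697, -1.252448658)
  | 1 => (0.904047196, -1.471654224)
  | 2 => (0.742934136, -1.529085514)
  | 3 => (1.404292212, -1.179267298)
  | 4 => (1.354619901, -1.225125454)
  | 5 => (0.868063287, -1.460023666)
  | 6 => (1.460023666, -0.868063287)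

/-- The tabulated value of the generator of the invariant trace field. -/
def fieldTable : Fin 7 → ℚ × ℚ
  | 0 => (0, 1.732050808)
  | 1 => (-0.207106781, 0.978318343)
  | 2 => (0, 1)
  | 3 => (0.632778, -3.019170376)
  | 4 => (-0.760689853, 0.857873626)
  | 5 => (0.771844506, 1.1151425)
  | 6 => (0.771844506, -1.1151425)

theorem aeval_markedPoly (i : Fin 7) (x : ℂ) :
    aeval x (markedPoly i) = listEval x (markedList i) := by
  fin_cases i <;> simp [markedPoly, markedList, listEval, aeval_def, eval₂_ofNat] <;> ring

theorem gauss_markedTable (i : Fin 7) : gauss (markedTable i) = markedValue i := by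
  fin_cases i <;> apply Complex.ext <;> simp [gauss, markedTable, markedValue]

theorem gauss_fieldTable (i : Fin 7) : gauss (fieldTable i) = fieldValue i := by
  fin_cases i <;> apply Complex.ext <;> simp [gauss, fieldTable, fieldValue] <;> norm_num

/-- The first, second and fourth bounds put a root within `10 ^ (-37)` of the centre, as `25 / 10 ^
39 < 1 / 10 ^ 37`. The third makes the linear term dominate on a disc containing the tabulated one.
The next two give `|z| < 2` and `|z| > 1`; the last is the rounding error of the table. -/
theorem marked_root_estimates : ∀ i : Fin 7,
    gaussNormSq (gaussHorner (markedCentre i) (markedList i)).1 ≤ (1 / 10 ^ 39) ^ 2 ∧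
    markedSlope i ^ 2 ≤ gaussNormSq (gaussHorner (markedCentre i) (markedList i)).2 ∧
    1 ≤ markedSlope i - listTaylor 2 (markedList i) * (1 / 10 ^ 8 + 1 / 10 ^ 9) ∧
    (markedList i).length ≤ 25 ∧
    gaussNormSq (markedCentre i) ≤ (19 / 10) ^ 2 ∧
    (11 / 10) ^ 2 ≤ gaussNormSq (markedCentre i) ∧
    gaussNormSq (markedCentre i - markedTable i) ≤ (9 / 10 ^ 10) ^ 2 := by
  decide +kernel

/-- The Lipschitz bound `10 ^ 25` is why `z` is needed to within `10 ^ (-37)`. The lower bound on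
the imaginary part shows that `τ` is not real. -/
theorem field_value_estimates : ∀ i : Fin 7,
    gaussNormSq ((gaussHorner (markedCentre i) (tauList i)).1 - fieldTable i)
      ≤ (9 / 10 ^ 9) ^ 2 ∧
    listLipschitz 2 (tauList i) ≤ 10 ^ 25 ∧ 1 / 4 ≤ |(fieldTable i).2| := by
  decide +kernel

theorem exists_isTabulatedRoot_near (i : Fin 7) :
    ∃ z, aeval z (markedPoly i) = 0 ∧ ‖z - gauss (markedCentre i)‖ ≤ 1 / 10 ^ 37 := by
  obtain ⟨h1, h2, h3, h4, h5, -, h6⟩ := marked_root_estimates i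
  have e := gauss_gaussHorner (markedCentre i) (markedList i)
  have hT : 0 ≤ listTaylor 2 (markedList i) := listTaylor_nonneg (by norm_num) _
  have hm : (1 : ℚ) ≤ markedSlope i := by
    linarith [mul_nonneg hT (by norm_num : (0 : ℚ) ≤ 1 / 10 ^ 8 + 1 / 10 ^ 9)]
  have b1 := norm_gauss_le (by norm_num) h1
  have b2 := le_norm_gauss h2
  rw [e.1] at b1
  rw [e.2] at b2
  push_cast at b1
  have hm' : (1 : ℝ) ≤ markedSlope i := by exact_mod_cast hm
  have h4' : ((markedList i).length : ℝ) ≤ 25 := by exact_mod_cast h4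
  obtain ⟨z, hz, hzx⟩ := exists_root_norm_sub_le (markedList i) (gauss (markedCentre i))
    (δ := 1 / 10 ^ 37) (by norm_num) (by
      calc ((markedList i).length : ℝ) * ‖listEval (gauss (markedCentre i)) (markedList i)‖
          ≤ 25 * (1 / 10 ^ 39) := by gcongr
        _ < 1 / 10 ^ 37 * 1 := by norm_num
        _ ≤ _ := by gcongr; linarith)
  exact ⟨z, by rw [aeval_markedPoly, hz], hzx⟩

theorem norm_markedCentre_sub_le (i : Fin 7) :
    ‖gauss (markedCentre i) - markedValue i‖ ≤ 9 / 10 ^ 10 := by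
  have h := norm_gauss_le (by norm_num) (marked_root_estimates i).2.2.2.2.2.2
  rw [gauss_sub, gauss_markedTable] at h
  simpa using h

theorem exists_isTabulatedRoot (i : Fin 7) :
    ∃ z, IsTabulatedRoot (markedPoly i) (markedValue i) z := by
  obtain ⟨z, hz, hzc⟩ := exists_isTabulatedRoot_near i
  refine ⟨z, hz, ?_⟩
  calc ‖z - markedValue i‖
      ≤ ‖z - gauss (markedCentre i)‖ + ‖gauss (markedCentre i) - markedValue i‖ :=
        norm_sub_le_norm_sub_add_norm_sub ..
    _ ≤ 1 / 10 ^ 37 + 9 / 10 ^ 10 := add_le_add hzc (norm_markedCentre_sub_le i)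
    _ < 1 / 10 ^ 8 := by norm_num

section

variable {i : Fin 7} {z : ℂ} (hz : IsTabulatedRoot (markedPoly i) (markedValue i) z)
include hz

/-- Every root matching the nine-digit table agrees with the centre to 37 digits, so numerical facts
checked at the centre apply to it. -/
theorem IsTabulatedRoot.norm_sub_markedCentre_le : ‖z - gauss (markedCentre i)‖ ≤ 1 / 10 ^ 37 := by
  obtain ⟨h1, h2, h3, -, h5, -, -⟩ := marked_root_estimates i
  have e := gauss_gaussHorner (markedCentre i) (markedList i)
  have b1 := norm_gauss_le (by norm_num) h1
  have b2 := le_norm_gauss h2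
  have b5 := norm_gauss_le (by norm_num) h5
  rw [e.1] at b1
  rw [e.2] at b2
  push_cast at b1 b5
  have h3' : (1 : ℝ) ≤ markedSlope i - listTaylor 2 (markedList i) * (1 / 10 ^ 8 + 1 / 10 ^ 9) := by
    have := (Rat.cast_le (K := ℝ)).2 h3
    push_cast at this
    exact this
  refine norm_sub_le_of_root (markedList i) (r := 1 / 10 ^ 8 + 1 / 10 ^ 9) (R := 2) ?_
    (by rw [← aeval_markedPoly, hz.1]) ?_ ?_ (by norm_num)
  · push_cast
    linarith
  · calc ‖z - gauss (markedCentre i)‖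
        ≤ ‖z - markedValue i‖ + ‖markedValue i - gauss (markedCentre i)‖ :=
          norm_sub_le_norm_sub_add_norm_sub ..
      _ ≤ 1 / 10 ^ 8 + 9 / 10 ^ 10 :=
          add_le_add hz.2.le (by rw [norm_sub_rev]; exact norm_markedCentre_sub_le i)
      _ ≤ _ := by norm_num
  · calc ‖listEval (gauss (markedCentre i)) (markedList i)‖ ≤ 1 / 10 ^ 39 := b1
      _ < 1 / 10 ^ 37 * 1 := by norm_num
      _ ≤ _ := by gcongr; linarith

theorem IsTabulatedRoot.one_lt_norm : 1 < ‖z‖ := by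
  have h := hz.norm_sub_markedCentre_le
  have b := le_norm_gauss (marked_root_estimates i).2.2.2.2.2.1
  have := norm_sub_norm_le (gauss (markedCentre i)) z
  rw [norm_sub_rev] at this
  push_cast at b
  linarith

theorem IsTabulatedRoot.norm_tau_sub_lt : ‖listEval z (tauList i) - fieldValue i‖ < 1 / 10 ^ 8 := by
  have h := hz.norm_sub_markedCentre_le
  obtain ⟨h1, h2, -⟩ := field_value_estimates i
  have hc := norm_gauss_le (by norm_num) (marked_root_estimates i).2.2.2.2.1
  have b1 := norm_gauss_le (by norm_num) h1
  rw [gauss_sub, (gauss_gaussHorner _ _).1, gauss_fieldTable] at b1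
  push_cast at b1 hc
  have hz2 : ‖z‖ ≤ ((2 : ℚ) : ℝ) := by
    have := norm_add_le (z - gauss (markedCentre i)) (gauss (markedCentre i))
    rw [sub_add_cancel] at this
    push_cast
    linarith
  have hL := norm_listEval_sub_le hz2 (y := gauss (markedCentre i)) (by push_cast; linarith)
    (tauList i)
  have h2' : ((listLipschitz 2 (tauList i) : ℚ) : ℝ) ≤ 10 ^ 25 := by exact_mod_cast h2
  calc ‖listEval z (tauList i) - fieldValue i‖ ≤ _ + _ :=
        norm_sub_le_norm_sub_add_norm_sub _ (listEval (gauss (markedCentre i)) (tauList i)) _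
    _ ≤ 10 ^ 25 * (1 / 10 ^ 37) + 9 / 10 ^ 9 := by
        refine add_le_add (hL.trans ?_) b1
        gcongr
    _ < 1 / 10 ^ 8 := by norm_num

theorem IsTabulatedRoot.tau_im_ne_zero : (listEval z (tauList i)).im ≠ 0 := by
  intro h0
  have h := Complex.abs_im_le_norm (listEval z (tauList i) - fieldValue i)
  have h1 := hz.norm_tau_sub_lt
  have h2 : (1 / 4 : ℝ) ≤ |((fieldTable i).2 : ℝ)| := by
    have := (Rat.cast_le (K := ℝ)).2 (field_value_estimates i).2.2
    push_cast at this
    exact this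
  rw [Complex.sub_im, h0, zero_sub, abs_neg, ← gauss_fieldTable] at h
  change |((fieldTable i).2 : ℝ)| ≤ _ at h
  rw [← gauss_fieldTable] at h1
  linarith

end

/-! ### Evaluation of words in a marked pair -/

/-- The reversed quotient of the division of a reversed list by the reversed monic list `1 :: p`,
with `n` coefficients. -/
def listDivAux (p : List ℚ) : ℕ → List ℚ → List ℚ
  | 0, _ => []
  | _ + 1, [] => []
  | n + 1, a :: l => a :: listDivAux p n (listAdd l (listScale (-a) p))

/-- The quotient of the division of `l` by the monic `p`. -/
def listDiv (l p : List ℚ) : List ℚ :=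
  (listDivAux p.reverse.tail (l.length + 1 - p.length) l.reverse).reverse

/-- Whether the polynomial with coefficients `l` is a multiple of the monic one with coefficients
`p`. -/
def listIsMultiple (p l : List ℚ) : Bool :=
  (listAdd l (listScale (-1) (listMul (listDiv l p) p))).all (· = 0)

theorem listEval_eq_zero_of_all (x : ℂ) {l : List ℚ} (h : l.all (· = 0)) : listEval x l = 0 := by
  induction l with
  | nil => rfl
  | cons a l ih =>
    simp only [List.all_cons, Bool.and_eq_true, decide_eq_true_eq] at h
    rw [listEval, h.1, ih h.2]
    simp

/-- The test multiplies the quotient back, so correctness of the division algorithm plays no role.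
-/
theorem listEval_eq_zero_of_isMultiple {x : ℂ} {p l : List ℚ} (hp : listEval x p = 0)
    (h : listIsMultiple p l) : listEval x l = 0 := by
  have := listEval_eq_zero_of_all x h
  rw [listEval_listAdd, listEval_listScale, listEval_listMul, hp] at this
  simpa using this

/-- Coordinates with respect to `1, f, w, f * w`, as coefficient lists of polynomials in `t`. -/
abbrev CombList : Type := List ℚ × List ℚ × List ℚ × List ℚ

namespace CombList

def mulLeft (s : List ℚ) : CombList → CombList
  | (a, b, c, d) =>
    (listScale (-1) (listAdd b (listAdd (listMul s c) (0 :: d))),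
      listAdd a (listAdd (0 :: listAdd b c) (listMul (listAdd [0, 0, 1] (listScale (-1) s)) d)),
      listAdd (0 :: c) d, listScale (-1) c)

def mulRight : CombList → CombList
  | (a, b, c, d) => (listScale (-1) c, listScale (-1) d, listAdd a (0 :: c), listAdd b (0 :: d))

/-- From the product with a generator to the product with its inverse. -/
def conj : CombList → CombList → CombList
  | (a, b, c, d), (a', b', c', d') =>
    (listAdd (0 :: a) (listScale (-1) a'), listAdd (0 :: b) (listScale (-1) b'),
      listAdd (0 :: c) (listScale (-1) c'), listAdd (0 :: d) (listScale (-1) d'))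

/-- The product with a letter: `(true, e)` is `f ^ ± 1` and `(false, e)` is `w ^ ± 1`. -/
def mulLetter (s : List ℚ) (x : CombList) : Bool × Bool → CombList
  | (true, true) => mulLeft s x
  | (true, false) => conj x (mulLeft s x)
  | (false, true) => mulRight x
  | (false, false) => conj x (mulRight x)

/-- Whether the element is `1` modulo `p`. -/
def isOne (p : List ℚ) : CombList → Bool
  | (a, b, c, d) => listIsMultiple p (listAdd a [-1]) && listIsMultiple p b && listIsMultiple p c
      && listIsMultiple p d

/-- The matrix with the given coordinates. -/
def toMatrix (f w : Matrix (Fin 2) (Fin 2) ℂ) (t : ℂ) : CombList → Matrix (Fin 2) (Fin 2) ℂ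
  | (a, b, c, d) => comb f w (listEval t a) (listEval t b) (listEval t c) (listEval t d)

variable {f w : SL(2, ℂ)} {t s : ℂ} {sl : List ℚ}

theorem toMatrix_mulLeft (h : IsMarkedPair (f : Matrix (Fin 2) (Fin 2) ℂ) w t s)
    (hs : listEval t sl = s) (x : CombList) :
    (mulLeft sl x).toMatrix f w t = x.toMatrix f w t * (f : Matrix (Fin 2) (Fin 2) ℂ) := by
  obtain ⟨a, b, c, d⟩ := x
  change _ = comb f w _ _ _ _ * ((f : SL(2, ℂ)) : Matrix (Fin 2) (Fin 2) ℂ)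
  rw [h.comb_mul_left]
  simp only [mulLeft, toMatrix, listEval_listAdd, listEval_listScale, listEval_listMul, hs,
    listEval]
  push_cast
  congr 1 <;> ring

theorem toMatrix_mulRight (h : IsMarkedPair (f : Matrix (Fin 2) (Fin 2) ℂ) w t s) (x : CombList) :
    (mulRight x).toMatrix f w t = x.toMatrix f w t * (w : Matrix (Fin 2) (Fin 2) ℂ) := by
  obtain ⟨a, b, c, d⟩ := x
  change _ = comb f w _ _ _ _ * ((w : SL(2, ℂ)) : Matrix (Fin 2) (Fin 2) ℂ)
  rw [h.comb_mul_right]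
  simp only [mulRight, toMatrix, listEval_listAdd, listEval_listScale, listEval]
  push_cast
  congr 1 <;> ring

theorem toMatrix_conj (f w : Matrix (Fin 2) (Fin 2) ℂ) (t : ℂ) (x y : CombList) :
    (conj x y).toMatrix f w t = t • x.toMatrix f w t - y.toMatrix f w t := by
  obtain ⟨a, b, c, d⟩ := x
  obtain ⟨a', b', c', d'⟩ := y
  rw [sub_eq_add_neg, ← neg_one_smul ℂ (toMatrix f w t (a', b', c', d'))]
  simp only [conj, toMatrix, smul_comb, comb_add, listEval_listAdd, listEval_listScale, listEval]
  push_cast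
  congr 1 <;> ring

/-- The element of `SL(2, ℂ)` given by a letter. -/
def letter (f w : SL(2, ℂ)) (l : Bool × Bool) : SL(2, ℂ) :=
  cond l.2 (cond l.1 f w) (cond l.1 f w)⁻¹

theorem toMatrix_mulLetter (h : IsMarkedPair (f : Matrix (Fin 2) (Fin 2) ℂ) w t s)
    (hs : listEval t sl = s) (x : CombList) (l : Bool × Bool) :
    (mulLetter sl x l).toMatrix f w t
      = x.toMatrix f w t * (letter f w l : Matrix (Fin 2) (Fin 2) ℂ) := by
  obtain ⟨_ | _, _ | _⟩ := l
  · simp only [mulLetter, letter, cond_false, toMatrix_conj, toMatrix_mulRight h,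
      Matrix.SpecialLinearGroup.coe_inv_fin_two, mul_sub, mul_smul_comm, mul_one, h.trace_right]
  · exact toMatrix_mulRight h x
  · simp only [mulLetter, letter, cond_false, cond_true, toMatrix_conj, toMatrix_mulLeft h hs,
      Matrix.SpecialLinearGroup.coe_inv_fin_two, mul_sub, mul_smul_comm, mul_one, h.trace_left]
  · exact toMatrix_mulLeft h hs x

theorem toMatrix_foldl (h : IsMarkedPair (f : Matrix (Fin 2) (Fin 2) ℂ) w t s)
    (hs : listEval t sl = s) (L : List (Bool × Bool)) (x : CombList) :
    (L.foldl (mulLetter sl) x).toMatrix f w t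
      = x.toMatrix f w t * ((L.map (letter f w)).prod : SL(2, ℂ)) := by
  induction L generalizing x with
  | nil => simp
  | cons l L ih =>
    rw [List.foldl_cons, ih, toMatrix_mulLetter h hs, List.map_cons, List.prod_cons,
      Matrix.SpecialLinearGroup.coe_mul, mul_assoc]

theorem toMatrix_eq_one {f w : Matrix (Fin 2) (Fin 2) ℂ} {p : List ℚ} (hp : listEval t p = 0)
    {x : CombList} (hx : x.isOne p) : x.toMatrix f w t = 1 := by
  obtain ⟨a, b, c, d⟩ := x
  simp only [isOne, Bool.and_eq_true] at hx
  obtain ⟨⟨⟨ha, hb⟩, hc⟩, hd⟩ := hx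
  have ha' := listEval_eq_zero_of_isMultiple hp ha
  rw [listEval_listAdd] at ha'
  simp only [listEval, mul_zero, add_zero, Rat.cast_neg, Rat.cast_one] at ha'
  rw [toMatrix, eq_neg_of_add_eq_zero_left ha', listEval_eq_zero_of_isMultiple hp hb,
    listEval_eq_zero_of_isMultiple hp hc, listEval_eq_zero_of_isMultiple hp hd]
  simp [comb]

/-- A word of which the coordinates reduce to those of `1` is trivial. -/
theorem lift_eq_one (h : IsMarkedPair (f : Matrix (Fin 2) (Fin 2) ℂ) w t s)
    (hs : listEval t sl = s) {p : List ℚ} (hp : listEval t p = 0) {x : FreeGroup Bool}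
    (hx : (x.toWord.foldl (mulLetter sl) ([1], [], [], [])).isOne p) :
    FreeGroup.lift (fun b => cond b f w) x = 1 := by
  have h1 := toMatrix_foldl h hs x.toWord ([1], [], [], [])
  rw [toMatrix_eq_one hp hx] at h1
  have h2 : toMatrix f w t ([1], [], [], []) = 1 := by simp [toMatrix, comb, listEval]
  rw [h2, one_mul] at h1
  rw [← FreeGroup.mk_toWord (x := x), FreeGroup.lift_mk]
  exact Subtype.ext h1.symm

end CombList

/-! ### Triviality of the quasi-relators and algebraic relations between the traces. -/

theorem map_quasiRelatorOne {Γ Δ : Type*} [Group Γ] [Group Δ] (φ : Γ →* Δ) (f w : Γ) (j : Fin 6) :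
    φ (quasiRelatorOne f w j) = quasiRelatorOne (φ f) (φ w) j := by
  fin_cases j <;> simp [quasiRelatorOne]

theorem map_quasiRelatorTwo {Γ Δ : Type*} [Group Γ] [Group Δ] (φ : Γ →* Δ) (f w : Γ) (j : Fin 6) :
    φ (quasiRelatorTwo f w j) = quasiRelatorTwo (φ f) (φ w) j := by
  fin_cases j <;> simp [quasiRelatorTwo]

/-- The coefficients of a monic polynomial of which the trace `tr f` is a root. -/
def traceList : Fin 7 → List ℚ
  | 0 => [4, 0, -2, 0, 1]
  | 1 => [-1, 2, 1, -2, 1]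
  | 2 => [2, -2, 1]
  | 3 => [1, -3, -11, 29, 25, -72, -3, 73, -35, -19, 23, -8, 1]
  | 4 => [2, 2, -3, 1]
  | 5 => [-16, 0, 8, 0, -4, 0, 1]
  | 6 => [-16, 0, 24, 0, -8, 0, 1]

/-- The coefficients of `tr (f⁻¹ w)` as a polynomial in `tr f`. -/
def traceThreeList : Fin 7 → List ℚ
  | 0 | 5 | 6 => [0, 0, 1 / 2]
  | 1 | 2 | 3 | 4 => [0, 1]

/-- The coordinates are polynomials in `t` alone, with `s` substituted; they are reduced modulo
`traceList` only in the final test. -/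
theorem isOne_quasiRelatorOne : ∀ j : Fin 6, CombList.isOne (traceList j.castSucc)
    ((quasiRelatorOne (FreeGroup.of true) (FreeGroup.of false) j).toWord.foldl
      (CombList.mulLetter (traceThreeList j.castSucc)) ([1], [], [], [])) := by
  decide +kernel

theorem isOne_quasiRelatorTwo : ∀ j : Fin 6, CombList.isOne (traceList j.castSucc)
    ((quasiRelatorTwo (FreeGroup.of true) (FreeGroup.of false) j).toWord.foldl
      (CombList.mulLetter (traceThreeList j.castSucc)) ([1], [], [], [])) := by
  decide +kernel

section

variable {i : Fin 7} {z : ℂ}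

/-- `markedTrace` is `(z ^ 2 + 1 - P(z)) / z` for `P` the marked polynomial, that is, `z + 1/z` at a
root. -/
theorem mul_markedTrace (hz : aeval z (markedPoly i) = 0) :
    z * markedTrace i z = z ^ 2 + 1 := by
  fin_cases i <;> simp [markedPoly, aeval_def, eval₂_ofNat] at hz <;> simp only [markedTrace] <;>
    linear_combination -hz

theorem ne_zero_of_markedPoly (hz : aeval z (markedPoly i) = 0) : z ≠ 0 := by
  rintro rfl
  simpa using mul_markedTrace hz

theorem markedTraceThree_eq (hz : aeval z (markedPoly i) = 0) :
    listEval (markedTrace i z) (traceThreeList i) = markedTraceThree i z := by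
  have h0 := ne_zero_of_markedPoly hz
  have h := mul_markedTrace hz
  have key : i = 0 ∨ i = 5 ∨ i = 6 → markedTrace i z ^ 2 = 2 * markedTraceThree i z := by
    intro hi
    apply mul_left_cancel₀ (pow_ne_zero 2 h0)
    rw [← mul_pow, h]
    rcases hi with rfl | rfl | rfl <;> simp [markedPoly, aeval_def, eval₂_ofNat] at hz <;>
      simp only [markedTraceThree] <;> linear_combination hz
  fin_cases i <;> simp [traceThreeList, listEval, markedTraceThree] <;>
    simp [markedTraceThree] at key <;> linear_combination key / 2

/-- `P` is palindromic of degree `2 d`, so `P(z) = z ^ d q(z + 1/z)`, where `q` is given by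
`traceList`; likewise in the other cases. -/
theorem listEval_traceList_0 {t : ℂ} (hz : aeval z (markedPoly 0) = 0) (h : z * t = z ^ 2 + 1) :
    listEval t (traceList 0) = 0 := by
  have h0 : z ^ 4 ≠ 0 := pow_ne_zero _ (ne_zero_of_markedPoly hz)
  apply (mul_eq_zero_iff_left h0).1
  have e : z ^ 4 * listEval t (traceList 0) = (z * t) ^ 4 - 2 * z ^ 2 * (z * t) ^ 2 + 4 * z ^ 4 :=
      by simp [traceList, listEval]; ring
  simp [markedPoly, aeval_def, eval₂_ofNat] at hz
  rw [e, h]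
  linear_combination hz

theorem listEval_traceList_1 {t : ℂ} (hz : aeval z (markedPoly 1) = 0) (h : z * t = z ^ 2 + 1) :
    listEval t (traceList 1) = 0 := by
  have h0 : z ^ 4 ≠ 0 := pow_ne_zero _ (ne_zero_of_markedPoly hz)
  apply (mul_eq_zero_iff_left h0).1
  have e : z ^ 4 * listEval t (traceList 1) = (z * t) ^ 4 - 2 * z ^ 1 * (z * t) ^ 3 + z ^ 2 * (z *
      t) ^ 2 + 2 * z ^ 3 * (z * t) ^ 1 - z ^ 4 := by simp [traceList, listEval]; ring
  simp [markedPoly, aeval_def, eval₂_ofNat] at hz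
  rw [e, h]
  linear_combination hz

theorem listEval_traceList_2 {t : ℂ} (hz : aeval z (markedPoly 2) = 0) (h : z * t = z ^ 2 + 1) :
    listEval t (traceList 2) = 0 := by
  have h0 : z ^ 2 ≠ 0 := pow_ne_zero _ (ne_zero_of_markedPoly hz)
  apply (mul_eq_zero_iff_left h0).1
  have e : z ^ 2 * listEval t (traceList 2) = (z * t) ^ 2 - 2 * z ^ 1 * (z * t) ^ 1 + 2 * z ^ 2 :=
      by simp [traceList, listEval]; ring
  simp [markedPoly, aeval_def, eval₂_ofNat] at hz
  rw [e, h]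
  linear_combination hz

theorem listEval_traceList_3 {t : ℂ} (hz : aeval z (markedPoly 3) = 0) (h : z * t = z ^ 2 + 1) :
    listEval t (traceList 3) = 0 := by
  have h0 : z ^ 12 ≠ 0 := pow_ne_zero _ (ne_zero_of_markedPoly hz)
  apply (mul_eq_zero_iff_left h0).1
  have e : z ^ 12 * listEval t (traceList 3) = (z * t) ^ 12 - 8 * z ^ 1 * (z * t) ^ 11 + 23 * z ^
      2 * (z * t) ^ 10 - 19 * z ^ 3 * (z * t) ^ 9 - 35 * z ^ 4 * (z * t) ^ 8 + 73 * z ^ 5 * (z *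
      t) ^ 7 - 3 * z ^ 6 * (z * t) ^ 6 - 72 * z ^ 7 * (z * t) ^ 5 + 25 * z ^ 8 * (z * t) ^ 4 + 29
      * z ^ 9 * (z * t) ^ 3 - 11 * z ^ 10 * (z * t) ^ 2 - 3 * z ^ 11 * (z * t) ^ 1 + z ^ 12 := by
      simp [traceList, listEval]; ring
  simp [markedPoly, aeval_def, eval₂_ofNat] at hz
  rw [e, h]
  linear_combination hz

theorem listEval_traceList_4 {t : ℂ} (hz : aeval z (markedPoly 4) = 0) (h : z * t = z ^ 2 + 1) :
    listEval t (traceList 4) = 0 := by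
  have h0 : z ^ 3 ≠ 0 := pow_ne_zero _ (ne_zero_of_markedPoly hz)
  apply (mul_eq_zero_iff_left h0).1
  have e : z ^ 3 * listEval t (traceList 4) = (z * t) ^ 3 - 3 * z ^ 1 * (z * t) ^ 2 + 2 * z ^ 2 *
      (z * t) ^ 1 + 2 * z ^ 3 := by simp [traceList, listEval]; ring
  simp [markedPoly, aeval_def, eval₂_ofNat] at hz
  rw [e, h]
  linear_combination hz

theorem listEval_traceList_5 {t : ℂ} (hz : aeval z (markedPoly 5) = 0) (h : z * t = z ^ 2 + 1) :
    listEval t (traceList 5) = 0 := by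
  have h0 : z ^ 6 ≠ 0 := pow_ne_zero _ (ne_zero_of_markedPoly hz)
  apply (mul_eq_zero_iff_left h0).1
  have e : z ^ 6 * listEval t (traceList 5) = (z * t) ^ 6 - 4 * z ^ 2 * (z * t) ^ 4 + 8 * z ^ 4 *
      (z * t) ^ 2 - 16 * z ^ 6 := by simp [traceList, listEval]; ring
  simp [markedPoly, aeval_def, eval₂_ofNat] at hz
  rw [e, h]
  linear_combination hz

theorem listEval_traceList_6 {t : ℂ} (hz : aeval z (markedPoly 6) = 0) (h : z * t = z ^ 2 + 1) :
    listEval t (traceList 6) = 0 := by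
  have h0 : z ^ 6 ≠ 0 := pow_ne_zero _ (ne_zero_of_markedPoly hz)
  apply (mul_eq_zero_iff_left h0).1
  have e : z ^ 6 * listEval t (traceList 6) = (z * t) ^ 6 - 8 * z ^ 2 * (z * t) ^ 4 + 24 * z ^ 4 *
      (z * t) ^ 2 - 16 * z ^ 6 := by simp [traceList, listEval]; ring
  simp [markedPoly, aeval_def, eval₂_ofNat] at hz
  rw [e, h]
  linear_combination hz

theorem listEval_traceList (hz : aeval z (markedPoly i) = 0) :
    listEval (markedTrace i z) (traceList i) = 0 := by
  have h := mul_markedTrace hz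
  fin_cases i
  exacts [listEval_traceList_0 hz h, listEval_traceList_1 hz h, listEval_traceList_2 hz h,
    listEval_traceList_3 hz h, listEval_traceList_4 hz h, listEval_traceList_5 hz h,
    listEval_traceList_6 hz h]

end

theorem tau_eq (i : Fin 7) (z : ℂ) : listEval z (tauList i) =
    ![1 - 2 * markedTraceThree 0 z, 1 - markedTrace 1 z, 1 - markedTrace 2 z,
      markedTrace 3 z ^ 2 - 2, 1 - markedTrace 4 z, 1 - markedTraceThree 5 z,
      markedTraceThree 6 z - 1] i := by
  fin_cases i <;> simp [tauList, listEval_listAdd, listEval_listMul, listEval, markedTrace,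
    markedTraceThree] <;> ring

section

variable {i : Fin 7} {z : ℂ} (hz : IsTabulatedRoot (markedPoly i) (markedValue i) z)
include hz

theorem IsTabulatedRoot.aeval_tau : aeval (listEval z (tauList i)) (fieldPoly i) = 0 := by
  have h1 := listEval_traceList hz.1
  have h2 := markedTraceThree_eq hz.1
  rw [tau_eq]
  fin_cases i <;>
    simp [traceList, listEval, traceThreeList, fieldPoly, aeval_def, eval₂_ofNat] at h1 h2 ⊢
  · rw [← h2]; linear_combination h1
  · linear_combination h1
  · linear_combination h1
  -- With `q` the polynomial of `traceList 3`, `fieldPoly 3` at `t ^ 2 - 2` equals `q(t) q(-t)`; the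
  -- cofactor is `q(-t)`.
  · generalize markedTrace 3 z = t at h1
    linear_combination (1 + 3 * t - 11 * t ^ 2 - 29 * t ^ 3 + 25 * t ^ 4 + 72 * t ^ 5 - 3 * t ^ 6
      - 73 * t ^ 7 - 35 * t ^ 8 + 19 * t ^ 9 + 23 * t ^ 10 + 8 * t ^ 11 + t ^ 12) * h1
  · linear_combination -h1
  · rw [← h2]; linear_combination -h1 / 8
  · rw [← h2]; linear_combination h1 / 8

theorem IsTabulatedRoot.minpoly_tau : minpoly ℚ (listEval z (tauList i)) = fieldPoly i :=
  (minpoly.eq_of_irreducible_of_monic (irreducible_fieldPoly i) hz.aeval_tau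
    (monic_fieldPoly i)).symm

end

/-! ### Comparison of the generated fields. -/

theorem adjoin_pair_eq_adjoin {x s τ : ℂ} (hx : x ∈ IntermediateField.adjoin ℚ {τ})
    (hs : s ∈ IntermediateField.adjoin ℚ {τ}) (hτ : τ ∈ IntermediateField.adjoin ℚ {x, s}) :
    IntermediateField.adjoin ℚ {x, s} = IntermediateField.adjoin ℚ {τ} := by
  refine le_antisymm (IntermediateField.adjoin_le_iff.2 ?_)
    (IntermediateField.adjoin_simple_le_iff.2 hτ)
  rintro y (rfl | rfl)
  exacts [hx, hs]

theorem affine_mem (K : IntermediateField ℚ ℂ) {x : ℂ} (a b : ℚ) (hx : x ∈ K) :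
    (a : ℂ) + b * x ∈ K :=
  add_mem (SubfieldClass.ratCast_mem K a) (mul_mem (SubfieldClass.ratCast_mem K b) hx)

theorem adjoin_sq_pair_eq_of_affine {t s τ : ℂ} {a b c : ℚ} (hb : b ≠ 0) (hτ : τ = a + b * s)
    (ht : t ^ 2 = c * s ∨ t = s) :
    IntermediateField.adjoin ℚ {t ^ 2, s} = IntermediateField.adjoin ℚ {τ} := by
  have hs : s ∈ IntermediateField.adjoin ℚ {τ} := by
    have hb' : (b : ℂ) ≠ 0 := by exact_mod_cast hb
    have := affine_mem _ (-a / b) (1 / b) (IntermediateField.mem_adjoin_simple_self ℚ τ)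
    rwa [show ((-a / b : ℚ) : ℂ) + (1 / b : ℚ) * τ = s by
      rw [hτ]; push_cast; field_simp; ring] at this
  refine adjoin_pair_eq_adjoin ?_ hs ?_
  · rcases ht with ht | rfl
    · rw [ht]
      exact mul_mem (SubfieldClass.ratCast_mem _ c) hs
    · exact pow_mem hs 2
  · rw [hτ]
    exact affine_mem _ a b (IntermediateField.subset_adjoin ℚ _ (by simp))

/-- The polynomial `E(x ^ 2) + x O(x ^ 2)` vanishing at `t` expresses `t` in terms of `t ^ 2`. -/
theorem mem_adjoin_sq_sub_two {t : ℂ} (ht : listEval t (traceList 3) = 0)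
    (hmin : minpoly ℚ (t ^ 2 - 2) = fieldPoly 3) :
    t ∈ IntermediateField.adjoin ℚ {t ^ 2 - 2} := by
  -- The odd part `O` has degree below 12, the degree of `t ^ 2 - 2`, so it cannot vanish there.
  have hO : listEval (t ^ 2 - 2 + 2) [-3, 29, -72, 73, -19, -8] ≠ 0 := by
    intro h0
    have hd : minpoly ℚ (t ^ 2 - 2) ∣ (listPoly [-3, 29, -72, 73, -19, -8]).comp (X + C 2) := by
      apply minpoly.dvd
      rw [aeval_comp, aeval_listPoly, ← h0]
      simp
    have hne : (listPoly [-3, 29, -72, 73, -19, -8]).comp (X + C 2) ≠ 0 := by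
      intro h
      -- After the shift by 2, the value at `-2` is the constant coefficient `-3`.
      have := congrArg (eval (-2)) h
      simp [listPoly] at this
    have h1 := natDegree_le_of_dvd hd hne
    have h2 : (fieldPoly 3).natDegree = 12 := by
      simp only [fieldPoly]
      compute_degree!
    rw [hmin, h2, natDegree_comp, natDegree_X_add_C, mul_one] at h1
    have := natDegree_listPoly_le [-3, 29, -72, 73, -19, -8]
    simp at this
    omega
  have hmem : ∀ l : List ℚ,
      listEval (t ^ 2 - 2 + 2) l ∈ IntermediateField.adjoin ℚ {t ^ 2 - 2} := by
    intro l
    have h2 : t ^ 2 - 2 + 2 ∈ IntermediateField.adjoin ℚ {t ^ 2 - 2} :=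
      add_mem (IntermediateField.mem_adjoin_simple_self ℚ _) (ofNat_mem _ 2)
    induction l with
    | nil => exact zero_mem _
    | cons a l ih => exact add_mem (SubfieldClass.ratCast_mem _ a) (mul_mem h2 ih)
  have key : t * listEval (t ^ 2 - 2 + 2) [-3, 29, -72, 73, -19, -8]
      = -listEval (t ^ 2 - 2 + 2) [1, -11, 25, -3, -35, 23, 1] := by
    simp [traceList, listEval] at ht ⊢
    linear_combination ht
  have := div_mem (neg_mem (hmem [1, -11, 25, -3, -35, 23, 1]))
    (hmem [-3, 29, -72, 73, -19, -8])
  rwa [← eq_div_of_mul_eq hO key] at this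

theorem IsTabulatedRoot.adjoin_eq {i : Fin 7} {z : ℂ}
    (hz : IsTabulatedRoot (markedPoly i) (markedValue i) z) :
    IntermediateField.adjoin ℚ {markedTrace i z ^ 2, markedTraceThree i z}
      = IntermediateField.adjoin ℚ {listEval z (tauList i)} := by
  have h1 := listEval_traceList hz.1
  have h2 := markedTraceThree_eq hz.1
  have hmin := hz.minpoly_tau
  rw [tau_eq] at hmin ⊢
  have hsq : ∀ {t s : ℂ}, listEval t [0, 0, 1 / 2] = s → t ^ 2 = (2 : ℚ) * s ∨ t = s := by
    rintro t s rfl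
    left
    simp [listEval]
    ring
  fin_cases i
  · exact adjoin_sq_pair_eq_of_affine (a := 1) (b := -2) (by norm_num)
      (by simp; ring) (hsq h2)
  · exact adjoin_sq_pair_eq_of_affine (a := 1) (b := -1) (c := 1) (by norm_num)
      (by simp [markedTraceThree]; ring) (Or.inr rfl)
  · exact adjoin_sq_pair_eq_of_affine (a := 1) (b := -1) (c := 1) (by norm_num)
      (by simp [markedTraceThree]; ring) (Or.inr rfl)
  · refine adjoin_pair_eq_adjoin ?_ (mem_adjoin_sq_sub_two h1 hmin) ?_
    · have := pow_mem (mem_adjoin_sq_sub_two h1 hmin) 2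
      exact this
    · exact sub_mem (IntermediateField.subset_adjoin ℚ _ (by simp)) (ofNat_mem _ 2)
  · exact adjoin_sq_pair_eq_of_affine (a := 1) (b := -1) (c := 1) (by norm_num)
      (by simp [markedTraceThree]; ring) (Or.inr rfl)
  · exact adjoin_sq_pair_eq_of_affine (a := 1) (b := -1) (by norm_num)
      (by simp; ring) (hsq h2)
  · exact adjoin_sq_pair_eq_of_affine (a := -1) (b := 1) (by norm_num)
      (by simp; ring) (hsq h2)

/-- The trace parameters avoid the degenerate values, as the generator of the invariant trace field
is not real. -/
theorem IsTabulatedRoot.trace_ne {i : Fin 7} {z : ℂ}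
    (hz : IsTabulatedRoot (markedPoly i) (markedValue i) z) :
    markedTrace i z ≠ 0 ∧ markedTraceThree i z ≠ 2 ∧
      markedTraceThree i z ≠ markedTrace i z ^ 2 - 2 := by
  have h2 := markedTraceThree_eq hz.1
  have hts : markedTrace i z ^ 2 = 2 * markedTraceThree i z ∨
      markedTrace i z = markedTraceThree i z := by
    rw [← h2]
    fin_cases i <;> simp [traceThreeList, listEval] <;> left <;> ring
  -- In each case `τ` is a rational polynomial in `s`, so a rational `s` would make it real.
  have hs : ∀ q : ℚ, markedTraceThree i z ≠ q := by
    intro q hq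
    have hτ := hz.tau_im_ne_zero
    rw [tau_eq] at hτ
    have e : markedTraceThree 1 z = markedTrace 1 z ∧ markedTraceThree 2 z = markedTrace 2 z ∧
      markedTraceThree 3 z = markedTrace 3 z ∧ markedTraceThree 4 z = markedTrace 4 z :=
      ⟨rfl, rfl, rfl, rfl⟩
    fin_cases i <;> simp [sq, e] at hq hτ <;> simp [hq] at hτ
  generalize markedTrace i z = t at *
  generalize markedTraceThree i z = s at *
  have h0 : s ≠ 0 := by simpa using hs 0
  have h2 : s ≠ 2 := by simpa using hs 2
  rcases hts with hts | rfl
  -- If `t ^ 2 = 2 s`, then `s = t ^ 2 - 2` forces `s = 2`. If `t = s`, it forces `s` to be `2` or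
  -- `-1`.
  · refine ⟨?_, h2, fun h => h2 ?_⟩
    · rintro rfl
      exact h0 (by linear_combination -hts / 2)
    · linear_combination -h - hts
  · refine ⟨h0, h2, fun h => ?_⟩
    have h3 : (t - 2) * (t + 1) = 0 := by linear_combination -h
    rcases mul_eq_zero.1 h3 with h4 | h4
    · exact h2 (sub_eq_zero.1 h4)
    · exact hs (-1) (by push_cast; exact eq_neg_of_add_eq_zero_left h4)

theorem det_markedMatrixF (i : Fin 7) (z : ℂ) : (markedMatrixF i z).det = 1 := by
  simp [markedMatrixF, Matrix.det_fin_two_of]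

theorem det_markedMatrixW {i : Fin 7} {z : ℂ} (hz : aeval z (markedPoly i) = 0) :
    (markedMatrixW i z).det = 1 := by
  rw [markedMatrixW, Matrix.det_fin_two_of]
  linear_combination mul_markedTrace hz

theorem isMarkedPair {i : Fin 7} {z : ℂ} (hz : aeval z (markedPoly i) = 0) :
    IsMarkedPair (markedMatrixF i z) (markedMatrixW i z) (markedTrace i z)
      (markedTraceThree i z) where
  det_left := det_markedMatrixF i z
  det_right := det_markedMatrixW hz
  trace_left := by simp [markedMatrixF, Matrix.trace_fin_two_of]
  trace_right := by simp [markedMatrixW, Matrix.trace_fin_two_of]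
  trace_mul := by
    simp only [markedMatrixF, markedMatrixW, Matrix.mul_fin_two, Matrix.trace_fin_two_of]
    ring

theorem theorem4 (i : Fin 7) :
    (∃ z : ℂ, IsTabulatedRoot (markedPoly i) (markedValue i) z) ∧
    ∀ z : ℂ, IsTabulatedRoot (markedPoly i) (markedValue i) z →
      ∃ f w : SL(2, ℂ),
        (f : Matrix (Fin 2) (Fin 2) ℂ) = markedMatrixF i z ∧
        (w : Matrix (Fin 2) (Fin 2) ℂ) = markedMatrixW i z ∧
        (∀ j : Fin 6, i = j.castSucc →
          quasiRelatorOne (toPSL f) (toPSL w) j = 1 ∧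
          quasiRelatorTwo (toPSL f) (toPSL w) j = 1) ∧
        ∃ τ : ℂ, IsTabulatedRoot (fieldPoly i) (fieldValue i) τ ∧
          minpoly ℚ τ = fieldPoly i ∧
          invariantTraceField (generatedGroup f w) = IntermediateField.adjoin ℚ {τ} := by
  refine ⟨exists_isTabulatedRoot i, fun z hz => ?_⟩
  obtain ⟨f, hf⟩ : ∃ f : SL(2, ℂ), (f : Matrix (Fin 2) (Fin 2) ℂ) = markedMatrixF i z :=
    ⟨⟨_, det_markedMatrixF i z⟩, rfl⟩
  obtain ⟨w, hw⟩ : ∃ w : SL(2, ℂ), (w : Matrix (Fin 2) (Fin 2) ℂ) = markedMatrixW i z :=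
    ⟨⟨_, det_markedMatrixW hz.1⟩, rfl⟩
  have h : IsMarkedPair (f : Matrix (Fin 2) (Fin 2) ℂ) w (markedTrace i z)
      (markedTraceThree i z) := by
    rw [hf, hw]
    exact isMarkedPair hz.1
  obtain ⟨ht0, hs2, hts⟩ := hz.trace_ne
  refine ⟨f, w, hf, hw, ?_, listEval z (tauList i), ⟨hz.aeval_tau, hz.norm_tau_sub_lt⟩,
    hz.minpoly_tau, ?_⟩
  · rintro j rfl
    have hs := markedTraceThree_eq hz.1
    have hp := listEval_traceList hz.1
    have h1 := CombList.lift_eq_one h hs hp (isOne_quasiRelatorOne j)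
    have h2 := CombList.lift_eq_one h hs hp (isOne_quasiRelatorTwo j)
    rw [map_quasiRelatorOne, FreeGroup.lift_apply_of, FreeGroup.lift_apply_of] at h1
    rw [map_quasiRelatorTwo, FreeGroup.lift_apply_of, FreeGroup.lift_apply_of] at h2
    rw [← map_quasiRelatorOne toPSL f w j, ← map_quasiRelatorTwo toPSL f w j]
    exact ⟨(congrArg toPSL h1).trans (map_one _), (congrArg toPSL h2).trans (map_one _)⟩
  · rw [invariantTraceField_generatedGroup h hz.one_lt_norm (mul_markedTrace hz.1) hs2 hts ht0,
      hz.adjoin_eq]
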